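/- Let $N\ge 4$, let $\Omega\subset\mathbb R^N$ be an open set with $0\in\Omega$, and put $\Omega'=\Omega\setminus\{0\}$. Let $g:\Omega'\times[0,\infty)\to[0,\infty)$ be measurable. Let $u\in L^1_{\rm loc}(\Omega')$ be such that its distributional Laplacian $\Delta u$ and bi-Laplacian $\Delta^2u$ on $\Omega'$ are functions in $L^1_{\rm loc}(\Omega')$, that $u\ge 0$ and $-\Delta u\ge 0$ a.e. in $\Omega'$, and that $\Delta^2u=g(x,u)$ in $\mathcal D'(\Omega')$, where $g(x,u)$ denotes the function $x\mapsto g(x,u(x))$ (which thus lies in $L^1_{\rm loc}(\Omega')$). Then: 1. $u\in L^1_{\rm loc}(\Omega)$ and $g(x,u)\in L^1_{\rm loc}(\Omega)$; 2. there are constants $\alpha,\beta\ge 0$ such that $\Delta^2u=g(x,u)+\alpha\,\delta_0-\beta\,\Delta\delta_0$ in $\mathcal D'(\Omega)$, where $\delta_0$ is the Dirac mass at $0$; 3. $u$ belongs to the local Marcinkiewicz (weak $L^p$) space $M^{p}_{\rm loc}(\Omega)$ with $p=\frac{N}{N-2}$: for every compact $K\subset\Omega$ there is a constant $C$ such that $|\{x\in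 K: |u(x)|>t\}|\le C\,t^{-p}$ for all $t>0$. -/

import Mathlib

open MeasureTheory TopologicalSpace
open scoped Distributions LineDeriv NNReal

/-- The open set `Ω' = Ω \ {0}`. -/
def punctured {N : ℕ} (Ω : Opens (EuclideanSpace ℝ (Fin N))) :
    Opens (EuclideanSpace ℝ (Fin N)) :=
  ⟨(Ω : Set (EuclideanSpace ℝ (Fin N))) \ {0}, Ω.isOpen.sdiff isClosed_singleton⟩

/-- The distribution `φ ↦ ∫ f φ dx` on the open set `Ω` given by a locally integrable function `f`
on `Ω` (the values of `f` outside `Ω` are irrelevant). It is only meaningful for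
`LocallyIntegrableOn f Ω`, which is therefore always stated along with it. -/
noncomputable def regularDistribution {N : ℕ} (Ω : Opens (EuclideanSpace ℝ (Fin N)))
    (f : EuclideanSpace ℝ (Fin N) → ℝ) : 𝓓'(Ω, ℝ) where
  __ := (TestFunction.integralAgainstBilinCLM (ContinuousLinearMap.mul ℝ ℝ) volume f :
    𝓓(Ω, ℝ) →L[ℝ] ℝ)

theorem regularDistribution_apply {N : ℕ} {Ω : Opens (EuclideanSpace ℝ (Fin N))}
    {f : EuclideanSpace ℝ (Fin N) → ℝ} (hf : LocallyIntegrableOn f Ω) (φ : 𝓓(Ω, ℝ)) :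
    regularDistribution Ω f φ = ∫ x, φ x * f x :=
  TestFunction.integralAgainstBilinCLM_eq_integral hf

/-- The distributional Laplacian `Δ T = ∑ i, ∂ᵢ ∂ᵢ T`. -/
noncomputable def distribLaplacian {N : ℕ} {Ω : Opens (EuclideanSpace ℝ (Fin N))}
    (T : 𝓓'(Ω, ℝ)) : 𝓓'(Ω, ℝ) :=
  ∑ i : Fin N, ∂_{EuclideanSpace.single i (1 : ℝ)} (∂_{EuclideanSpace.single i (1 : ℝ)} T)

theorem distribLaplacian_apply {N : ℕ} {Ω : Opens (EuclideanSpace ℝ (Fin N))}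
    (T : 𝓓'(Ω, ℝ)) (φ : 𝓓(Ω, ℝ)) :
    distribLaplacian T φ = T (∑ i : Fin N,
      ∂_{EuclideanSpace.single i (1 : ℝ)} (∂_{EuclideanSpace.single i (1 : ℝ)} φ)) := by
  rw [distribLaplacian, map_sum]
  have h : ∀ s : Finset (Fin N), (∑ i ∈ s, ∂_{EuclideanSpace.single i (1 : ℝ)}
      (∂_{EuclideanSpace.single i (1 : ℝ)} T)) φ = ∑ i ∈ s, T (∂_{EuclideanSpace.single i (1 : ℝ)}
      (∂_{EuclideanSpace.single i (1 : ℝ)} φ)) := by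
    intro s
    induction s using Finset.cons_induction with
    | empty => rfl
    | cons a s ha ih =>
      rw [Finset.sum_cons, Finset.sum_cons, ← ih]
      change (∂_{EuclideanSpace.single a (1 : ℝ)} (∂_{EuclideanSpace.single a (1 : ℝ)} T)) φ + _ = _
      congr 1
      rw [Distribution.lineDerivOp_apply_apply, Distribution.lineDerivOp_apply_apply]
      congr 1
      rw [LineDeriv.lineDerivOp_neg, neg_neg]
  exact h _

/-- The Marcinkiewicz (weak `L^p`) space `M^p(μ)`: measurable functions with
`sup_{t > 0} t ^ p * μ {|f| > t} < ∞`. -/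
def MemMarcinkiewicz {X : Type*} [MeasurableSpace X] (f : X → ℝ) (p : ℝ) (μ : Measure X) : Prop :=
  AEStronglyMeasurable f μ ∧
    ∃ C : ℝ≥0, ∀ t : ℝ, 0 < t → μ {x | t < |f x|} ≤ ENNReal.ofReal (C / t ^ p)

/-- The local Marcinkiewicz space `M^p_loc(Ω)` (with respect to Lebesgue measure). -/
def MemMarcinkiewiczLoc {N : ℕ} (f : EuclideanSpace ℝ (Fin N) → ℝ) (p : ℝ)
    (Ω : Set (EuclideanSpace ℝ (Fin N))) : Prop :=
  ∀ K ⊆ Ω, IsCompact K → MemMarcinkiewicz f p (volume.restrict K)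

/-! The theorem is two applications of a Brezis–Lions lemma (`brezis_lions`): if `u ≥ 0` and `Δu = v
≤ 0` off the origin, then `u` and `v` are integrable near `0`, and `Δu = v - β δ₀` on `Ω` with `β ≥
0`. Applied to `u` it gives `Δu = v - β δ₀`; applied to `-v ≥ 0`, whose Laplacian is `-g(x, u) ≤ 0`,
it gives `Δv = g(x, u) + α δ₀`. Taking the Laplacian of the first identity and inserting the second
yields `Δ²u = g(x, u) + α δ₀ - β Δδ₀`.

The lemma rests on smooth subharmonic cutoffs `φ n` that vanish near `0` and tend to `1` elsewhere
(`exists_isBarrierSequence`). Testing with `(1 + ‖x‖) φ n`, localised, bounds the integrals of `φ n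
u / ‖x‖` and `φ n |v|` near `0` uniformly in `n`, and Fatou's lemma gives integrability of `u / ‖x‖`
and `v`. Testing then with `χ φ n`, the defect `v - Δu` at `χ` is the limit of `∫ χ Δ(φ n) u`. This
is nonnegative for `χ ≥ 0`, and it is zero when `χ 0 = 0`, because then `|χ Δ(φ n) u|` is dominated
by a multiple of `u / ‖x‖`. Hence the defect is a nonnegative multiple of `δ₀`.

For the weak-type bound, testing `Δu = v - β δ₀` with a truncated, regularised Newtonian kernel
centred at `y` bounds small averages of `u` around `y` by the Newtonian potential of a finite
measure (`exists_le_newtonPotential`). Lebesgue differentiation makes this a bound for `u y` almost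
everywhere, and potentials of finite measures lie in weak `L ^ (N / (N - 2))`
(`volume_lt_newtonPotential_le`). -/

open Filter Metric Set
open scoped Topology ContDiff

/-! ### Pointwise partial derivatives and Laplacians, the product rule, and radial functions of `‖x‖
^ 2`. -/

section Calculus

variable {N : ℕ}

/-- The `i`-th partial derivative. -/
noncomputable def partialDeriv (i : Fin N) (f : EuclideanSpace ℝ (Fin N) → ℝ) :
    EuclideanSpace ℝ (Fin N) → ℝ :=
  fun x => lineDeriv ℝ f x (EuclideanSpace.single i 1)

/-- The classical Laplacian as a sum of iterated partial derivatives. -/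
noncomputable def classicalLaplacian (f : EuclideanSpace ℝ (Fin N) → ℝ) :
    EuclideanSpace ℝ (Fin N) → ℝ :=
  fun x => ∑ i, partialDeriv i (partialDeriv i f) x

variable {f g : EuclideanSpace ℝ (Fin N) → ℝ} {x : EuclideanSpace ℝ (Fin N)}

theorem Filter.EventuallyEq.partialDeriv (h : f =ᶠ[𝓝 x] g) (i : Fin N) :
    partialDeriv i f =ᶠ[𝓝 x] partialDeriv i g :=
  h.eventuallyEq_nhds.mono fun _ hy => hy.lineDeriv_eq

theorem Filter.EventuallyEq.classicalLaplacian (h : f =ᶠ[𝓝 x] g) :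
    classicalLaplacian f =ᶠ[𝓝 x] classicalLaplacian g := by
  refine h.eventuallyEq_nhds.mono fun y hy => ?_
  exact Finset.sum_congr rfl fun i _ => ((hy.partialDeriv i).partialDeriv i).eq_of_nhds

theorem partialDeriv_zero (i : Fin N) :
    partialDeriv i (fun _ : EuclideanSpace ℝ (Fin N) => (0 : ℝ)) = fun _ => 0 := by
  ext x
  simp [partialDeriv, lineDeriv]

theorem partialDeriv_eq_zero_of_notMem_tsupport (hx : x ∉ tsupport f) (i : Fin N) :
    partialDeriv i f x = 0 := by
  have h : f =ᶠ[𝓝 x] fun _ => 0 := notMem_tsupport_iff_eventuallyEq.1 hx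
  rw [(h.partialDeriv i).eq_of_nhds, partialDeriv_zero]

theorem classicalLaplacian_zero :
    classicalLaplacian (fun _ : EuclideanSpace ℝ (Fin N) => (0 : ℝ)) = fun _ => 0 := by
  ext x
  simp [classicalLaplacian, partialDeriv_zero]

theorem classicalLaplacian_eq_zero_of_notMem_tsupport (hx : x ∉ tsupport f) :
    classicalLaplacian f x = 0 := by
  have h : f =ᶠ[𝓝 x] fun _ => 0 := notMem_tsupport_iff_eventuallyEq.1 hx
  rw [h.classicalLaplacian.eq_of_nhds, classicalLaplacian_zero]

theorem ContDiffOn.partialDeriv {U : Set (EuclideanSpace ℝ (Fin N))} (hU : IsOpen U)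
    (hf : ContDiffOn ℝ ∞ f U) (i : Fin N) : ContDiffOn ℝ ∞ (partialDeriv i f) U := by
  have h : ContDiffOn ℝ ∞ (fun x => fderiv ℝ f x (EuclideanSpace.single i 1)) U :=
    (hf.fderiv_of_isOpen hU le_rfl).clm_apply contDiffOn_const
  refine h.congr fun x hx => ?_
  exact ((hf.contDiffAt (hU.mem_nhds hx)).differentiableAt (by simp)).lineDeriv_eq_fderiv

theorem ContDiffOn.classicalLaplacian {U : Set (EuclideanSpace ℝ (Fin N))} (hU : IsOpen U)
    (hf : ContDiffOn ℝ ∞ f U) : ContDiffOn ℝ ∞ (classicalLaplacian f) U :=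
  ContDiffOn.sum fun i _ => (hf.partialDeriv hU i).partialDeriv hU i

theorem ContDiff.continuous_partialDeriv (hf : ContDiff ℝ ∞ f) (i : Fin N) :
    Continuous (partialDeriv i f) :=
  continuousOn_univ.1 (hf.contDiffOn.partialDeriv isOpen_univ i).continuousOn

theorem ContDiff.continuous_classicalLaplacian (hf : ContDiff ℝ ∞ f) :
    Continuous (classicalLaplacian f) :=
  continuousOn_univ.1 (hf.contDiffOn.classicalLaplacian isOpen_univ).continuousOn

theorem partialDeriv_comp_sub (y : EuclideanSpace ℝ (Fin N)) (i : Fin N) :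
    partialDeriv i (fun z => f (z - y)) = fun z => partialDeriv i f (z - y) := by
  ext x
  simp only [partialDeriv, lineDeriv, add_sub_right_comm]

theorem classicalLaplacian_comp_sub (y : EuclideanSpace ℝ (Fin N)) :
    classicalLaplacian (fun z => f (z - y)) = fun z => classicalLaplacian f (z - y) := by
  ext x
  simp only [classicalLaplacian, partialDeriv_comp_sub]

theorem ContDiffAt.hasLineDerivAt_partialDeriv (hf : ContDiffAt ℝ ∞ f x) (i : Fin N) :
    HasLineDerivAt ℝ f (partialDeriv i f x) x (EuclideanSpace.single i 1) :=
  (hf.differentiableAt (by simp)).lineDifferentiableAt.hasLineDerivAt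

theorem HasLineDerivAt.mul_real {f' g' : ℝ} {v : EuclideanSpace ℝ (Fin N)}
    (hf : HasLineDerivAt ℝ f f' x v) (hg : HasLineDerivAt ℝ g g' x v) :
    HasLineDerivAt ℝ (fun y => f y * g y) (f' * g x + f x * g') x v := by
  have := HasDerivAt.fun_mul hf hg
  simpa [HasLineDerivAt] using this

theorem HasLineDerivAt.add_real {f' g' : ℝ} {v : EuclideanSpace ℝ (Fin N)}
    (hf : HasLineDerivAt ℝ f f' x v) (hg : HasLineDerivAt ℝ g g' x v) :
    HasLineDerivAt ℝ (fun y => f y + g y) (f' + g') x v :=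
  HasDerivAt.fun_add hf hg

theorem ContDiffAt.partialDeriv (hf : ContDiffAt ℝ ∞ f x) (i : Fin N) :
    ContDiffAt ℝ ∞ (partialDeriv i f) x := by
  have h : ContDiffAt ℝ ∞ (fun x => fderiv ℝ f x (EuclideanSpace.single i 1)) x :=
    (hf.fderiv_right le_rfl).clm_apply contDiffAt_const
  refine h.congr_of_eventuallyEq ?_
  have h1 : ∀ᶠ y in 𝓝 x, ContDiffAt ℝ 1 f y :=
    (hf.of_le (by norm_cast)).eventually (by simp)
  filter_upwards [h1] with y hy
  exact (hy.differentiableAt (by simp)).lineDeriv_eq_fderiv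

theorem partialDeriv_mul (hf : ContDiffAt ℝ ∞ f x) (hg : ContDiffAt ℝ ∞ g x) (i : Fin N) :
    partialDeriv i (fun y => f y * g y) x =
      partialDeriv i f x * g x + f x * partialDeriv i g x :=
  ((hf.hasLineDerivAt_partialDeriv i).mul_real (hg.hasLineDerivAt_partialDeriv i)).lineDeriv

/-- The product rule for the Laplacian. -/
theorem classicalLaplacian_mul {U : Set (EuclideanSpace ℝ (Fin N))} (hU : IsOpen U)
    (hf : ContDiffOn ℝ ∞ f U) (hg : ContDiffOn ℝ ∞ g U) (hx : x ∈ U) :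
    classicalLaplacian (fun y => f y * g y) x = classicalLaplacian f x * g x
      + 2 * ∑ i, partialDeriv i f x * partialDeriv i g x + f x * classicalLaplacian g x := by
  have hfU : ∀ y ∈ U, ContDiffAt ℝ ∞ f y := fun y hy => hf.contDiffAt (hU.mem_nhds hy)
  have hgU : ∀ y ∈ U, ContDiffAt ℝ ∞ g y := fun y hy => hg.contDiffAt (hU.mem_nhds hy)
  have key : ∀ i, partialDeriv i (partialDeriv i (fun y => f y * g y)) x =
      partialDeriv i (partialDeriv i f) x * g x + 2 * (partialDeriv i f x * partialDeriv i g x)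
        + f x * partialDeriv i (partialDeriv i g) x := by
    intro i
    have h1 : partialDeriv i (fun y => f y * g y) =ᶠ[𝓝 x]
        fun y => partialDeriv i f y * g y + f y * partialDeriv i g y := by
      filter_upwards [hU.mem_nhds hx] with y hy
      exact partialDeriv_mul (hfU y hy) (hgU y hy) i
    rw [(h1.partialDeriv i).eq_of_nhds]
    refine (((((hfU x hx).partialDeriv i).hasLineDerivAt_partialDeriv i).mul_real
      ((hgU x hx).hasLineDerivAt_partialDeriv i)).add_real
      (((hfU x hx).hasLineDerivAt_partialDeriv i).mul_real
      (((hgU x hx).partialDeriv i).hasLineDerivAt_partialDeriv i))).lineDeriv.trans ?_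
    ring
  simp only [classicalLaplacian, key, Finset.sum_add_distrib, Finset.sum_mul, Finset.mul_sum]

theorem hasLineDerivAt_comp_norm_sq {F : ℝ → ℝ} {F' : ℝ} (i : Fin N)
    (hF : HasDerivAt F F' (‖x‖ ^ 2)) :
    HasLineDerivAt ℝ (fun y => F (‖y‖ ^ 2)) (2 * x i * F') x (EuclideanSpace.single i 1) := by
  have h1 : HasFDerivAt (fun y : EuclideanSpace ℝ (Fin N) => ‖y‖ ^ 2) (2 • innerSL ℝ x) x :=
    (hasStrictFDerivAt_norm_sq x).hasFDerivAt
  have h2 := (hF.comp_hasFDerivAt x h1).hasLineDerivAt (EuclideanSpace.single i 1)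
  have h3 : (F' • 2 • innerSL ℝ x) (EuclideanSpace.single i 1) = 2 * x i * F' := by
    simp [EuclideanSpace.inner_single_right]
    ring
  rw [h3] at h2
  exact h2

theorem hasLineDerivAt_coord (i : Fin N) :
    HasLineDerivAt ℝ (fun y : EuclideanSpace ℝ (Fin N) => y i) 1 x
      (EuclideanSpace.single i 1) := by
  have := (EuclideanSpace.proj i : EuclideanSpace ℝ (Fin N) →L[ℝ] ℝ).hasFDerivAt
    (x := x) |>.hasLineDerivAt (EuclideanSpace.single i 1)
  simpa using this

theorem partialDeriv_comp_norm_sq {F : ℝ → ℝ} {F' : ℝ} (i : Fin N)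
    (hF : HasDerivAt F F' (‖x‖ ^ 2)) :
    partialDeriv i (fun y => F (‖y‖ ^ 2)) x = 2 * x i * F' :=
  (hasLineDerivAt_comp_norm_sq i hF).lineDeriv

/-- The Laplacian of a radial function, written as a function of `‖x‖ ^ 2`. -/
theorem classicalLaplacian_comp_norm_sq {F F' : ℝ → ℝ} {F'' : ℝ}
    (hF : ∀ᶠ q in 𝓝 (‖x‖ ^ 2), HasDerivAt F (F' q) q) (hF' : HasDerivAt F' F'' (‖x‖ ^ 2)) :
    classicalLaplacian (fun y => F (‖y‖ ^ 2)) x =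
      4 * ‖x‖ ^ 2 * F'' + 2 * N * F' (‖x‖ ^ 2) := by
  have key : ∀ i, partialDeriv i (partialDeriv i (fun y => F (‖y‖ ^ 2))) x =
      4 * F'' * (x i) ^ 2 + 2 * F' (‖x‖ ^ 2) := by
    intro i
    have hc : Tendsto (fun y : EuclideanSpace ℝ (Fin N) => ‖y‖ ^ 2) (𝓝 x) (𝓝 (‖x‖ ^ 2)) :=
      (continuous_norm.pow 2).tendsto x
    have h1 : partialDeriv i (fun y => F (‖y‖ ^ 2)) =ᶠ[𝓝 x]
        fun y => (y i + y i) * F' (‖y‖ ^ 2) := by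
      filter_upwards [hc.eventually hF] with y hy
      rw [partialDeriv_comp_norm_sq i hy]
      ring
    rw [(h1.partialDeriv i).eq_of_nhds]
    refine (((hasLineDerivAt_coord i).add_real (hasLineDerivAt_coord i)).mul_real
      (hasLineDerivAt_comp_norm_sq i hF')).lineDeriv.trans ?_
    ring
  have hn : ‖x‖ ^ 2 = ∑ i, (x i) ^ 2 := EuclideanSpace.real_norm_sq_eq x
  simp only [classicalLaplacian, key, Finset.sum_add_distrib, ← Finset.mul_sum, ← hn]
  simp
  ring

end Calculus

/-! ### Subharmonic cutoffs vanishing near the origin. -/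

section Barrier

/-- There is a smooth function on the line which vanishes on `(-∞, 0]`, is nondecreasing and convex
on `(-∞, 1]`, and takes the value `1` at `1`. -/
theorem exists_smooth_convex_profile :
    ∃ (k k' k'' : ℝ → ℝ) (C : ℝ), ContDiff ℝ ∞ k ∧ (∀ s, HasDerivAt k (k' s) s) ∧
      (∀ s, HasDerivAt k' (k'' s) s) ∧ (∀ s ≤ 0, k s = 0 ∧ k' s = 0 ∧ k'' s = 0) ∧
      (∀ s ≤ 1, (0 ≤ k s ∧ k s ≤ 1) ∧ (0 ≤ k' s ∧ k' s ≤ C) ∧ 0 ≤ k'' s ∧ k'' s ≤ C) ∧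
      k 1 = 1 := by
  set p := expNegInvGlue with hp
  -- For `s > 0` the profile is a multiple of `exp (-4 / s)`. The second derivative of `exp (-1 /
  -- r)` is `r⁻³ (r⁻¹ - 2) exp (-1 / r)`, nonnegative for `0 < r ≤ 1 / 2`; the substitution `r = s /
  -- 4` keeps `s ≤ 1` inside this range. The factor `c` normalises the value at `1`.
  set c : ℝ := (p (1 / 4))⁻¹ with hc
  have hpos : 0 < p (1 / 4) := expNegInvGlue.pos_of_pos (by norm_num)
  have hc0 : 0 < c := inv_pos.2 hpos
  set p' : ℝ → ℝ := fun s => (Polynomial.X ^ 2 : Polynomial ℝ).eval s⁻¹ * p s with hp'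
  set p'' : ℝ → ℝ := fun s =>
    (Polynomial.X ^ 2 * (Polynomial.X ^ 2 - Polynomial.derivative (Polynomial.X ^ 2)) :
      Polynomial ℝ).eval s⁻¹ * p s with hp''
  have hd1 : ∀ s, HasDerivAt p (p' s) s := by
    intro s
    have h := expNegInvGlue.hasDerivAt_polynomial_eval_inv_mul 1 s
    simp only [Polynomial.eval_one, one_mul, Polynomial.derivative_one, sub_zero, mul_one] at h
    exact h
  have hd2 : ∀ s, HasDerivAt p' (p'' s) s := fun s =>
    expNegInvGlue.hasDerivAt_polynomial_eval_inv_mul _ s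
  have hlin : ∀ s : ℝ, HasDerivAt (fun s : ℝ => s / 4) (1 / 4) s := fun s =>
    (hasDerivAt_id s).div_const 4
  have hcont' : Continuous fun s => c * (p' (s / 4) * (1 / 4)) :=
    continuous_const.mul (((expNegInvGlue.continuous_polynomial_eval_inv_mul _).comp
      (continuous_id.div_const 4)).mul continuous_const)
  have hcont'' : Continuous fun s => c * (p'' (s / 4) * (1 / 4) * (1 / 4)) :=
    continuous_const.mul ((((expNegInvGlue.continuous_polynomial_eval_inv_mul _).comp
      (continuous_id.div_const 4)).mul continuous_const).mul continuous_const)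
  obtain ⟨C1, hC1⟩ := (isCompact_Icc (a := (0 : ℝ)) (b := 1)).exists_bound_of_continuousOn
    hcont'.continuousOn
  obtain ⟨C2, hC2⟩ := (isCompact_Icc (a := (0 : ℝ)) (b := 1)).exists_bound_of_continuousOn
    hcont''.continuousOn
  have hzero : ∀ s ≤ (0 : ℝ), p (s / 4) = 0 := fun s hs =>
    expNegInvGlue.zero_of_nonpos (by linarith)
  have hC1' : 0 ≤ C1 := (norm_nonneg _).trans (hC1 0 (by simp))
  refine ⟨fun s => c * p (s / 4), fun s => c * (p' (s / 4) * (1 / 4)),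
    fun s => c * (p'' (s / 4) * (1 / 4) * (1 / 4)), max C1 C2, ?_, ?_, ?_, ?_, ?_, ?_⟩
  · exact contDiff_const.mul (expNegInvGlue.contDiff.comp (contDiff_id.div_const 4))
  · intro s
    exact ((hd1 (s / 4)).comp s (hlin s)).const_mul c
  · intro s
    exact (((hd2 (s / 4)).comp s (hlin s)).mul_const (1 / 4)).const_mul c
  · intro s hs
    simp [hp', hp'', hzero s hs]
  · intro s hs
    rcases le_or_gt s 0 with h0 | h0
    · simp [hp', hp'', hzero s h0, hC1']
    have hp0 : 0 < p (s / 4) := expNegInvGlue.pos_of_pos (by linarith)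
    refine ⟨⟨by positivity, ?_⟩, ⟨?_, ?_⟩, ?_, ?_⟩
    · have h1 : p (s / 4) ≤ p (1 / 4) := expNegInvGlue.monotone (by linarith)
      calc c * p (s / 4) ≤ c * p (1 / 4) := by gcongr
        _ = 1 := inv_mul_cancel₀ hpos.ne'
    · simp only [hp', Polynomial.eval_pow, Polynomial.eval_X]
      positivity
    · exact (le_abs_self _).trans ((hC1 s ⟨h0.le, hs⟩).trans (le_max_left _ _))
    · have h4 : (s / 4)⁻¹ ^ 2 - 2 * (s / 4)⁻¹ = (s / 4)⁻¹ * (4 / s - 2) := by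
        field_simp
      have h5 : 0 ≤ 4 / s - 2 := by
        rw [sub_nonneg, le_div_iff₀ h0]
        linarith
      have h6 : 0 ≤ (s / 4)⁻¹ ^ 2 - 2 * (s / 4)⁻¹ := by
        rw [h4]
        positivity
      have h7 : p'' (s / 4) = (s / 4)⁻¹ ^ 2 * ((s / 4)⁻¹ ^ 2 - 2 * (s / 4)⁻¹) * p (s / 4) := by
        simp only [hp'', Polynomial.eval_mul, Polynomial.eval_sub, Polynomial.eval_pow,
          Polynomial.eval_X, Polynomial.derivative_X_pow, Polynomial.eval_C]
        norm_num
      show 0 ≤ c * (p'' (s / 4) * (1 / 4) * (1 / 4))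
      rw [h7]
      positivity
    · exact (le_abs_self _).trans ((hC2 s ⟨h0.le, hs⟩).trans (le_max_right _ _))
  · exact inv_mul_cancel₀ hpos.ne'

/-- A sequence of smooth subharmonic cutoff functions, each vanishing near the origin, converging
to `1` off the origin with scale-invariant control of two derivatives. -/
structure IsBarrierSequence {N : ℕ} (φ : ℕ → EuclideanSpace ℝ (Fin N) → ℝ) (C : ℝ) : Prop where
  contDiff : ∀ n, ContDiff ℝ ∞ (φ n)
  vanish : ∀ n, φ n =ᶠ[𝓝 0] fun _ => 0
  nonneg : ∀ n x, 0 ≤ φ n x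
  le_one : ∀ n x, φ n x ≤ 1
  partialDeriv_eq : ∀ n, ∀ x ≠ 0, ∃ c : ℝ, 0 ≤ c ∧ ∀ i, partialDeriv i (φ n) x = c * x i
  abs_partialDeriv_le : ∀ n, ∀ x ≠ 0, ∀ i, |partialDeriv i (φ n) x| ≤ C / ‖x‖
  laplacian_nonneg : ∀ n, ∀ x ≠ 0, 0 ≤ classicalLaplacian (φ n) x
  laplacian_le : ∀ n, ∀ x ≠ 0, classicalLaplacian (φ n) x ≤ C / ‖x‖ ^ 2
  tendsto : ∀ x ≠ 0, Tendsto (fun n => φ n x) atTop (𝓝 1)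
  tendsto_partialDeriv : ∀ x ≠ 0, ∀ i, Tendsto (fun n => partialDeriv i (φ n) x) atTop (𝓝 0)
  tendsto_laplacian : ∀ x ≠ 0, Tendsto (fun n => classicalLaplacian (φ n) x) atTop (𝓝 0)

/-- The barrier is `k (1 - a n / ‖x‖ ^ 2)` with `a n → 0`. Off the origin `Δ ‖x‖⁻² = -2 (N - 4)
‖x‖⁻⁴`, so for `N ≥ 4` the argument of `k` is subharmonic, and a nondecreasing convex `k` preserves
this. The bounds are scale invariant because `k'` and `k''` vanish there unless `a n / ‖x‖ ^ 2 ≤ 1`.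
-/
theorem exists_isBarrierSequence {N : ℕ} (hN : 4 ≤ N) :
    ∃ (φ : ℕ → EuclideanSpace ℝ (Fin N) → ℝ) (C : ℝ), 0 ≤ C ∧ IsBarrierSequence φ C := by
  obtain ⟨k, k', k'', C, hk, hk1, hk2, hk0, hkb, hk_one⟩ := exists_smooth_convex_profile
  set a : ℕ → ℝ := fun n => 1 / ((n : ℝ) + 1) with ha
  have hapos : ∀ n, 0 < a n := fun n => Nat.one_div_pos_of_nat
  have hatend : Tendsto a atTop (𝓝 0) := tendsto_one_div_add_atTop_nhds_zero_nat
  have hC : 0 ≤ C := (hkb 0 zero_le_one).2.1.1.trans (hkb 0 zero_le_one).2.1.2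
  have hNr : (4 : ℝ) ≤ N := by exact_mod_cast hN
  have hq : ∀ x : EuclideanSpace ℝ (Fin N), x ≠ 0 → 0 < ‖x‖ ^ 2 := fun x hx => by positivity
  have hs1 : ∀ n, ∀ q : ℝ, 0 ≤ q → (q - a n) / q ≤ 1 := by
    intro n q h
    exact div_le_one_of_le₀ (by linarith [hapos n]) h
  have hdiv : ∀ n, ∀ q : ℝ, 0 < q → HasDerivAt (fun q => (q - a n) / q) (a n / q ^ 2) q := by
    intro n q h
    refine (((hasDerivAt_id q).sub_const (a n)).div (hasDerivAt_id q) h.ne').congr_deriv ?_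
    simp
  have hK : ∀ n, ∀ q : ℝ, 0 < q →
      HasDerivAt (fun q => k ((q - a n) / q)) (k' ((q - a n) / q) * (a n / q ^ 2)) q :=
    fun n q h => (hk1 _).comp q (hdiv n q h)
  have hK' : ∀ n, ∀ q : ℝ, 0 < q →
      HasDerivAt (fun q => k' ((q - a n) / q) * (a n / q ^ 2))
        (k'' ((q - a n) / q) * (a n / q ^ 2) * (a n / q ^ 2) +
          k' ((q - a n) / q) * (-2 * a n / q ^ 3)) q := by
    intro n q h
    have h1 : HasDerivAt (fun q => a n / q ^ 2) (-2 * a n / q ^ 3) q := by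
      refine ((hasDerivAt_const q (a n)).div (hasDerivAt_pow 2 q) (by positivity)).congr_deriv ?_
      field_simp
      ring
    exact ((hk2 _).comp q (hdiv n q h)).mul h1
  have hpd : ∀ n, ∀ x : EuclideanSpace ℝ (Fin N), x ≠ 0 → ∀ i,
      partialDeriv i (fun x => k ((‖x‖ ^ 2 - a n) / ‖x‖ ^ 2)) x =
        2 * (k' ((‖x‖ ^ 2 - a n) / ‖x‖ ^ 2) * (a n / (‖x‖ ^ 2) ^ 2)) * x i := by
    intro n x hx i
    refine (partialDeriv_comp_norm_sq (F := fun q => k ((q - a n) / q)) i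
      (hK n _ (hq x hx))).trans ?_
    ring
  have hlap : ∀ n, ∀ x : EuclideanSpace ℝ (Fin N), x ≠ 0 →
      classicalLaplacian (fun x => k ((‖x‖ ^ 2 - a n) / ‖x‖ ^ 2)) x =
        (4 * k'' ((‖x‖ ^ 2 - a n) / ‖x‖ ^ 2) * (a n / ‖x‖ ^ 2) ^ 2 +
          (2 * N - 8) * k' ((‖x‖ ^ 2 - a n) / ‖x‖ ^ 2) * (a n / ‖x‖ ^ 2)) / ‖x‖ ^ 2 := by
    intro n x hx
    have h0 := hq x hx
    refine (classicalLaplacian_comp_norm_sq (F := fun q => k ((q - a n) / q))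
      ((eventually_gt_nhds h0).mono fun q h => hK n q h) (hK' n _ h0)).trans ?_
    field_simp
    ring
  have hzero : ∀ n, ∀ q : ℝ, 0 < q → q ≤ a n → (q - a n) / q ≤ 0 := fun n q h h' =>
    div_nonpos_of_nonpos_of_nonneg (by linarith) h.le
  have hlim : ∀ x : EuclideanSpace ℝ (Fin N), x ≠ 0 →
      Tendsto (fun n => (‖x‖ ^ 2 - a n) / ‖x‖ ^ 2) atTop (𝓝 1) := by
    intro x hx
    have := (tendsto_const_nhds (x := ‖x‖ ^ 2)).sub hatend |>.div_const (‖x‖ ^ 2)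
    simpa [(hq x hx).ne'] using this
  have hlim0 : ∀ x : EuclideanSpace ℝ (Fin N), x ≠ 0 →
      Tendsto (fun n => a n / ‖x‖ ^ 2) atTop (𝓝 0) := by
    intro x hx
    simpa using hatend.div_const (‖x‖ ^ 2)
  have hvan : ∀ n, (fun x : EuclideanSpace ℝ (Fin N) => k ((‖x‖ ^ 2 - a n) / ‖x‖ ^ 2))
      =ᶠ[𝓝 0] fun _ => 0 := by
    intro n
    have hc : Tendsto (fun x : EuclideanSpace ℝ (Fin N) => ‖x‖ ^ 2) (𝓝 0) (𝓝 0) := by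
      have h : Continuous fun x : EuclideanSpace ℝ (Fin N) => ‖x‖ ^ 2 := continuous_norm.pow 2
      simpa using h.tendsto 0
    filter_upwards [hc.eventually (eventually_lt_nhds (hapos n))] with x hx
    rcases eq_or_ne x 0 with rfl | h0
    -- At the origin the quotient is `0` by the convention for division by zero, and `k 0 = 0`.
    · simpa using (hk0 0 le_rfl).1
    · exact (hk0 _ (hzero n _ (hq x h0) hx.le)).1
  have hcontk' : Continuous k' := continuous_iff_continuousAt.2 fun s => (hk2 s).continuousAt
  -- One constant for both bounds: the gradient needs `2 C`, the Laplacian `4 C + (2 N - 8) C`.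
  refine ⟨fun n x => k ((‖x‖ ^ 2 - a n) / ‖x‖ ^ 2), (4 + 2 * N) * C, by positivity, ?_⟩
  -- on the support of the derivatives one has `a n ≤ ‖x‖ ^ 2`
  have hcases : ∀ n, ∀ x : EuclideanSpace ℝ (Fin N), x ≠ 0 →
      (k' ((‖x‖ ^ 2 - a n) / ‖x‖ ^ 2) = 0 ∧ k'' ((‖x‖ ^ 2 - a n) / ‖x‖ ^ 2) = 0) ∨
        a n / ‖x‖ ^ 2 ≤ 1 := by
    intro n x hx
    rcases le_total (‖x‖ ^ 2) (a n) with h | h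
    · exact .inl (hk0 _ (hzero n _ (hq x hx) h)).2
    · exact .inr (div_le_one_of_le₀ h (by positivity))
  refine
    { contDiff := ?_, vanish := hvan, nonneg := ?_, le_one := ?_, partialDeriv_eq := ?_,
      abs_partialDeriv_le := ?_, laplacian_nonneg := ?_, laplacian_le := ?_, tendsto := ?_,
      tendsto_partialDeriv := ?_, tendsto_laplacian := ?_ }
  · intro n
    refine contDiff_iff_contDiffAt.2 fun x => ?_
    rcases eq_or_ne x 0 with rfl | h0
    · exact contDiffAt_const.congr_of_eventuallyEq (hvan n)
    · exact hk.contDiffAt.comp x ((((contDiff_norm_sq ℝ).contDiffAt).sub contDiffAt_const).div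
        (contDiff_norm_sq ℝ).contDiffAt (hq x h0).ne')
  · exact fun n x => (hkb _ (hs1 n _ (by positivity))).1.1
  · exact fun n x => (hkb _ (hs1 n _ (by positivity))).1.2
  · intro n x hx
    have := (hkb _ (hs1 n _ (hq x hx).le)).2.1.1
    have := hapos n
    exact ⟨_, by positivity, hpd n x hx⟩
  · intro n x hx i
    have hb := (hkb _ (hs1 n _ (hq x hx).le)).2.1
    have h0 := hapos n
    have hx0 : 0 < ‖x‖ := norm_pos_iff.2 hx
    have hxi : |x i| ≤ ‖x‖ := by simpa using PiLp.norm_apply_le x i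
    rw [hpd n x hx i]
    rcases hcases n x hx with h | h
    · simp only [h.1]
      simp only [zero_mul, mul_zero, abs_zero]
      positivity
    · rw [abs_mul, abs_of_nonneg (by have := hb.1; positivity)]
      have e1 : k' ((‖x‖ ^ 2 - a n) / ‖x‖ ^ 2) * (a n / ‖x‖ ^ 2) ≤ C * 1 :=
        mul_le_mul hb.2 h (by positivity) hC
      calc 2 * (k' ((‖x‖ ^ 2 - a n) / ‖x‖ ^ 2) * (a n / (‖x‖ ^ 2) ^ 2)) * |x i|
          = 2 * (k' ((‖x‖ ^ 2 - a n) / ‖x‖ ^ 2) * (a n / ‖x‖ ^ 2)) / ‖x‖ ^ 2 * |x i| := by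
            field_simp
        _ ≤ 2 * (C * 1) / ‖x‖ ^ 2 * ‖x‖ := by gcongr
        _ = 2 * C / ‖x‖ := by field_simp
        _ ≤ (4 + 2 * N) * C / ‖x‖ := by gcongr; linarith
  · intro n x hx
    have hb := (hkb _ (hs1 n _ (hq x hx).le)).2
    have h0 := hapos n
    have h1 := hb.1.1
    have h2 := hb.2.1
    have h3 : (0 : ℝ) ≤ 2 * N - 8 := by linarith
    rw [hlap n x hx]
    positivity
  · intro n x hx
    have hb := (hkb _ (hs1 n _ (hq x hx).le)).2
    have h0 := hapos n
    have h1 := hb.1.1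
    have h2 := hb.2.1
    have h3 : (0 : ℝ) ≤ 2 * N - 8 := by linarith
    rw [hlap n x hx]
    gcongr
    rcases hcases n x hx with h | h
    · simp only [h.1, h.2]
      simp only [zero_mul, mul_zero, add_zero]
      positivity
    · have hr : 0 ≤ a n / ‖x‖ ^ 2 := by positivity
      calc _ ≤ 4 * C * 1 ^ 2 + (2 * N - 8) * C * 1 := by
            gcongr
            · exact hb.2.2
            · exact hb.1.2
        _ ≤ (4 + 2 * N) * C := by nlinarith
  · intro x hx
    simpa [hk_one, Function.comp_def] using (hk.continuous.tendsto 1).comp (hlim x hx)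
  · intro x hx i
    have h1 := (hcontk'.tendsto 1).comp (hlim x hx)
    have h2 := (((h1.mul (hlim0 x hx)).const_mul 2).mul_const (x i)).div_const (‖x‖ ^ 2)
    simp only [mul_zero, zero_mul, zero_div] at h2
    refine h2.congr fun n => ?_
    rw [hpd n x hx i]
    have := hq x hx
    simp only [Function.comp]
    field_simp
  · intro x hx
    have h1 := (hcontk'.tendsto 1).comp (hlim x hx)
    have h2 := (h1.mul (hlim0 x hx)).const_mul (2 * N - 8 : ℝ)
    -- Only a bound on `k''` is at hand, not continuity, so its term is squeezed using the factor
    -- `(a n / ‖x‖ ^ 2) ^ 2`.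
    have h3 : Tendsto (fun n => 4 * (C * (a n / ‖x‖ ^ 2) ^ 2)) atTop (𝓝 0) := by
      simpa using (((hlim0 x hx).pow 2).const_mul C).const_mul 4
    have h4 : Tendsto (fun n => 4 * k'' ((‖x‖ ^ 2 - a n) / ‖x‖ ^ 2) * (a n / ‖x‖ ^ 2) ^ 2) atTop
        (𝓝 0) := by
      refine squeeze_zero (fun n => ?_) (fun n => ?_) h3
      · have := (hkb _ (hs1 n _ (hq x hx).le)).2.2.1
        positivity
      · have := (hkb _ (hs1 n _ (hq x hx).le)).2.2.2
        rw [mul_assoc]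
        gcongr
    have h5 := (h4.add h2).div_const (‖x‖ ^ 2)
    simp only [mul_zero, zero_div, add_zero] at h5
    refine h5.congr fun n => ?_
    rw [hlap n x hx]
    simp only [Function.comp]
    ring

end Barrier

/-! ### Distributional identities as integral identities. -/

section WeakLaplacian

variable {N : ℕ} {Ω : Opens (EuclideanSpace ℝ (Fin N))} {u v : EuclideanSpace ℝ (Fin N) → ℝ}

theorem ae_ne_zero_euclideanSpace (hN : 1 ≤ N) :
    ∀ᵐ x : EuclideanSpace ℝ (Fin N), x ≠ 0 := by
  have : Nonempty (Fin N) := ⟨⟨0, hN⟩⟩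
  exact compl_mem_ae_iff.2 (measure_singleton 0)

theorem MeasureTheory.LocallyIntegrableOn.integrable_continuousOn_mul {f : EuclideanSpace ℝ (Fin N) → ℝ}
    {K : Set (EuclideanSpace ℝ (Fin N))} (hu : LocallyIntegrableOn u Ω) (hK : IsCompact K)
    (hKΩ : K ⊆ Ω) (hf : ContinuousOn f K) (hsupp : ∀ x ∉ K, f x = 0) :
    Integrable fun x => f x * u x := by
  have h1 : IntegrableOn (fun x => f x * u x) K :=
    ((hu.mono_set hKΩ).integrableOn_isCompact hK).continuousOn_mul hf hK
  refine (integrableOn_iff_integrable_of_support_subset fun x hx => ?_).1 h1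
  by_contra hxK
  exact hx (by simp [hsupp x hxK])

theorem coe_sum_lineDerivOp_lineDerivOp (φ : 𝓓(Ω, ℝ)) :
    ⇑(∑ i : Fin N, ∂_{EuclideanSpace.single i (1 : ℝ)}
      (∂_{EuclideanSpace.single i (1 : ℝ)} φ) : 𝓓(Ω, ℝ)) = classicalLaplacian φ := by
  have h : ∀ (ψ : 𝓓(Ω, ℝ)) (i : Fin N),
      ⇑(∂_{EuclideanSpace.single i (1 : ℝ)} ψ : 𝓓(Ω, ℝ)) = partialDeriv i ψ := by
    intro ψ i
    ext x
    rw [TestFunction.lineDerivOp_eq_lineDerivCLM ℝ, TestFunction.lineDerivCLM_apply]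
    simp [partialDeriv]
  ext x
  simp [classicalLaplacian, h]

theorem distribLaplacian_regularDistribution_apply (hu : LocallyIntegrableOn u Ω) (φ : 𝓓(Ω, ℝ)) :
    distribLaplacian (regularDistribution Ω u) φ = ∫ x, classicalLaplacian φ x * u x := by
  rw [distribLaplacian_apply, regularDistribution_apply hu, coe_sum_lineDerivOp_lineDerivOp]

theorem integral_classicalLaplacian_mul_eq (hu : LocallyIntegrableOn u Ω)
    (hv : LocallyIntegrableOn v Ω)
    (h : distribLaplacian (regularDistribution Ω u) = regularDistribution Ω v)
    {ψ : EuclideanSpace ℝ (Fin N) → ℝ} (hψ : ContDiff ℝ ∞ ψ) (hc : HasCompactSupport ψ)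
    (hs : tsupport ψ ⊆ Ω) : ∫ x, classicalLaplacian ψ x * u x = ∫ x, ψ x * v x := by
  have := congrArg (fun T : 𝓓'(Ω, ℝ) => T ⟨ψ, hψ, hc, hs⟩) h
  simp only [distribLaplacian_regularDistribution_apply hu, regularDistribution_apply hv] at this
  exact this

end WeakLaplacian

/-! ### Integrability up to the origin. -/

section RemovableSingularity

variable {N : ℕ} {Ω : Opens (EuclideanSpace ℝ (Fin N))} {u v : EuclideanSpace ℝ (Fin N) → ℝ}
  {φ : ℕ → EuclideanSpace ℝ (Fin N) → ℝ} {C : ℝ} {ψ : EuclideanSpace ℝ (Fin N) → ℝ}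

/-- The three terms in the Laplacian of the product `ψ * f`. -/
noncomputable def laplacianMul (ψ f : EuclideanSpace ℝ (Fin N) → ℝ) :
    EuclideanSpace ℝ (Fin N) → ℝ :=
  fun x => classicalLaplacian ψ x * f x + 2 * ∑ i, partialDeriv i ψ x * partialDeriv i f x
    + ψ x * classicalLaplacian f x

/-- `ψ` need not be differentiable at the origin. The product rule survives there because `φ n`
vanishes in a neighbourhood, so both sides are zero. -/
theorem classicalLaplacian_mul_barrier (hφ : IsBarrierSequence φ C)
    (hψ : ContDiffOn ℝ ∞ ψ {0}ᶜ) (n : ℕ) :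
    classicalLaplacian (fun x => ψ x * φ n x) = laplacianMul ψ (φ n) := by
  ext x
  rcases eq_or_ne x 0 with rfl | hx
  · have h0 : (fun x => ψ x * φ n x) =ᶠ[𝓝 0] fun _ => 0 := by
      filter_upwards [hφ.vanish n] with y hy
      simp [hy]
    have h1 : ∀ i, partialDeriv i (φ n) 0 = 0 := fun i => by
      rw [((hφ.vanish n).partialDeriv i).eq_of_nhds, partialDeriv_zero]
    rw [h0.classicalLaplacian.eq_of_nhds, laplacianMul,
      (hφ.vanish n).classicalLaplacian.eq_of_nhds, (hφ.vanish n).eq_of_nhds,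
      classicalLaplacian_zero]
    simp [h1]
  · exact classicalLaplacian_mul isOpen_compl_singleton hψ (hφ.contDiff n).contDiffOn hx

/-- Multiplying by `φ n` removes a neighbourhood of the origin from the support, so `ψ * φ n` is an
admissible test function on the punctured set even if `ψ` is singular at `0`. -/
theorem barrier_test (hφ : IsBarrierSequence φ C)
    (hu : LocallyIntegrableOn u (punctured Ω)) (hv : LocallyIntegrableOn v (punctured Ω))
    (h : distribLaplacian (regularDistribution (punctured Ω) u) =
      regularDistribution (punctured Ω) v)
    (hψ : ContDiffOn ℝ ∞ ψ {0}ᶜ) (hc : HasCompactSupport ψ) (hs : tsupport ψ ⊆ Ω) (n : ℕ) :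
    Integrable (fun x => laplacianMul ψ (φ n) x * u x) ∧
    Integrable (fun x => ψ x * φ n x * v x) ∧
    ∫ x, laplacianMul ψ (φ n) x * u x = ∫ x, ψ x * φ n x * v x := by
  have h0 : (fun x => ψ x * φ n x) =ᶠ[𝓝 0] fun _ => 0 := by
    filter_upwards [hφ.vanish n] with y hy
    simp [hy]
  have hsm : ContDiff ℝ ∞ (fun x => ψ x * φ n x) := by
    refine contDiff_iff_contDiffAt.2 fun x => ?_
    rcases eq_or_ne x 0 with rfl | hx
    · exact contDiffAt_const.congr_of_eventuallyEq h0
    · exact (hψ.contDiffAt (isOpen_compl_singleton.mem_nhds hx)).mul (hφ.contDiff n).contDiffAt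
  have hcs : HasCompactSupport (fun x => ψ x * φ n x) := hc.mul_right
  have hsub : tsupport (fun x => ψ x * φ n x) ⊆ punctured Ω := by
    intro x hx
    refine ⟨hs (tsupport_mul_subset_left hx), ?_⟩
    rintro rfl
    exact notMem_tsupport_iff_eventuallyEq.2 h0 hx
  rw [← classicalLaplacian_mul_barrier hφ hψ n]
  exact ⟨LocallyIntegrableOn.integrable_continuousOn_mul hu hcs hsub
      hsm.continuous_classicalLaplacian.continuousOn
      fun x hx => classicalLaplacian_eq_zero_of_notMem_tsupport hx,
    LocallyIntegrableOn.integrable_continuousOn_mul hv hcs hsub hsm.continuous.continuousOn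
      fun x hx => image_eq_zero_of_notMem_tsupport (f := fun x => ψ x * φ n x) hx,
    integral_classicalLaplacian_mul_eq hu hv h hsm hcs hsub⟩

/-- A bound for `laplacianMul ψ (φ n)` uniform in `n`. -/
theorem abs_laplacianMul_le (hφ : IsBarrierSequence φ C) {x : EuclideanSpace ℝ (Fin N)}
    (hx : x ≠ 0) (n : ℕ) :
    |laplacianMul ψ (φ n) x| ≤ |classicalLaplacian ψ x| +
      2 * ∑ i, |partialDeriv i ψ x| * (C / ‖x‖) + |ψ x| * (C / ‖x‖ ^ 2) := by
  refine (abs_add_three _ _ _).trans ?_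
  refine add_le_add (add_le_add ?_ ?_) ?_
  · rw [abs_mul, abs_of_nonneg (hφ.nonneg n x)]
    exact mul_le_of_le_one_right (abs_nonneg _) (hφ.le_one n x)
  · rw [abs_mul, abs_two]
    gcongr
    refine (Finset.abs_sum_le_sum_abs _ _).trans (Finset.sum_le_sum fun i _ => ?_)
    rw [abs_mul]
    gcongr
    exact hφ.abs_partialDeriv_le n x hx i
  · rw [abs_mul, abs_of_nonneg (hφ.laplacian_nonneg n x hx)]
    gcongr
    exact hφ.laplacian_le n x hx

/-- Testing with `(1 + ‖x‖) * φ n`, which is subharmonic near the origin, controls both a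
nonnegative superharmonic function and its Laplacian there. -/
theorem integrableOn_ball_of_laplacian_nonpos (hN : 1 ≤ N) (hφ : IsBarrierSequence φ C)
    (hu : LocallyIntegrableOn u (punctured Ω)) (hv : LocallyIntegrableOn v (punctured Ω))
    (h : distribLaplacian (regularDistribution (punctured Ω) u) =
      regularDistribution (punctured Ω) v)
    (hu0 : ∀ᵐ x, x ∈ punctured Ω → 0 ≤ u x) (hv0 : ∀ᵐ x, x ∈ punctured Ω → 0 ≤ -v x)
    {δ : ℝ} (hδ : 0 < δ) (hball : closedBall (0 : EuclideanSpace ℝ (Fin N)) (2 * δ) ⊆ Ω) :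
    IntegrableOn (fun x => (N - 1) * ‖x‖⁻¹ * u x + (1 + ‖x‖) * -v x) (ball 0 δ) := by
  let η : ContDiffBump (0 : EuclideanSpace ℝ (Fin N)) := ⟨δ, 2 * δ, hδ, by linarith⟩
  -- The summand `‖x‖` has Laplacian `(N - 1) / ‖x‖`, which gives control of `u / ‖x‖` and not
  -- merely of `u`. The summand `1` keeps the weight in front of `v` from degenerating at the
  -- origin.
  set ψ : EuclideanSpace ℝ (Fin N) → ℝ := fun x => η x * (1 + ‖x‖) with hψdef
  have hψ : ContDiffOn ℝ ∞ ψ {0}ᶜ := η.contDiff.contDiffOn.mul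
    (contDiffOn_const.add fun x hx => (contDiffAt_norm ℝ hx).contDiffWithinAt)
  have hc : HasCompactSupport ψ := η.hasCompactSupport.mul_right
  have hsη : tsupport ψ ⊆ closedBall 0 (2 * δ) := by
    have h1 : tsupport ψ ⊆ tsupport η := tsupport_mul_subset_left
    rwa [η.tsupport_eq] at h1
  have hs : tsupport ψ ⊆ Ω := hsη.trans hball
  have hψ0 : ∀ x, 0 ≤ ψ x := fun x => mul_nonneg η.nonneg (by positivity)
  have hNr : (1 : ℝ) ≤ N := by exact_mod_cast hN
  set A : Set (EuclideanSpace ℝ (Fin N)) := tsupport ψ \ ball 0 δ with hA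
  have hAc : IsCompact A := hc.isCompact.diff isOpen_ball
  have hA0 : A ⊆ {0}ᶜ := fun x hx => by
    rintro rfl
    exact hx.2 (mem_ball_self hδ)
  have hAΩ : A ⊆ punctured Ω := fun x hx => ⟨hs hx.1, hA0 hx⟩
  -- uniform bound away from the origin
  obtain ⟨M, hM⟩ : ∃ M, ∀ x ∈ A, ∀ n, |laplacianMul ψ (φ n) x| ≤ M := by
    have hcont : ContinuousOn (fun x => |classicalLaplacian ψ x| +
        2 * ∑ i, |partialDeriv i ψ x| * (C / ‖x‖) + |ψ x| * (C / ‖x‖ ^ 2)) A := by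
      have hn : ∀ x ∈ A, ‖x‖ ≠ 0 := fun x hx => norm_ne_zero_iff.2 (hA0 hx)
      have h1 : ContinuousOn (fun x : EuclideanSpace ℝ (Fin N) => C / ‖x‖) A :=
        continuousOn_const.div continuous_norm.continuousOn hn
      have h2 : ContinuousOn (fun x : EuclideanSpace ℝ (Fin N) => C / ‖x‖ ^ 2) A :=
        continuousOn_const.div (continuous_norm.pow 2).continuousOn
          fun x hx => pow_ne_zero 2 (hn x hx)
      refine ((((hψ.classicalLaplacian isOpen_compl_singleton).continuousOn.mono hA0).abs).add
        (continuousOn_const.mul (continuousOn_finsetSum _ fun i _ => ?_))).add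
        ((hψ.continuousOn.mono hA0).abs.mul h2)
      exact ((hψ.partialDeriv isOpen_compl_singleton i).continuousOn.mono hA0).abs.mul h1
    obtain ⟨M, hM⟩ := hAc.exists_bound_of_continuousOn hcont
    exact ⟨M, fun x hx n => (abs_laplacianMul_le hφ (hA0 hx) n).trans
      ((le_abs_self _).trans (hM x hx))⟩
  -- lower bound near the origin
  have hlow : ∀ x ∈ ball (0 : EuclideanSpace ℝ (Fin N)) δ, x ≠ 0 → ∀ n,
      φ n x * ((N - 1) * ‖x‖⁻¹) ≤ laplacianMul ψ (φ n) x := by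
    intro x hx hx0 n
    have hq : 0 < ‖x‖ ^ 2 := by positivity
    have hev : ψ =ᶠ[𝓝 x] fun y => (fun q => 1 + √q) (‖y‖ ^ 2) := by
      filter_upwards [isOpen_ball.mem_nhds hx] with y hy
      have h1 : η y = 1 := η.one_of_mem_closedBall (ball_subset_closedBall hy)
      simp [hψdef, h1, Real.sqrt_sq]
    have hd1 : ∀ q : ℝ, 0 < q → HasDerivAt (fun q => 1 + √q) (1 / (2 * √q)) q := fun q hq =>
      (Real.hasDerivAt_sqrt hq.ne').const_add 1
    have hd2 : HasDerivAt (fun q => 1 / (2 * √q)) (-(1 / (4 * ‖x‖ ^ 3))) (‖x‖ ^ 2) := by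
      have h1 := ((Real.hasDerivAt_sqrt hq.ne').const_mul 2).inv (by positivity)
      simp only [one_div]
      refine h1.congr_deriv ?_
      rw [Real.sqrt_sq (norm_nonneg x)]
      field_simp
      ring
    have hx' : 0 < ‖x‖ := norm_pos_iff.2 hx0
    have hlapψ : classicalLaplacian ψ x = (N - 1) * ‖x‖⁻¹ := by
      rw [hev.classicalLaplacian.eq_of_nhds, classicalLaplacian_comp_norm_sq
        ((eventually_gt_nhds hq).mono hd1) hd2, Real.sqrt_sq (norm_nonneg x)]
      field_simp
      ring
    have hpdψ : ∀ i, partialDeriv i ψ x = x i / ‖x‖ := by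
      intro i
      rw [(hev.partialDeriv i).eq_of_nhds, partialDeriv_comp_norm_sq i (hd1 _ hq),
        Real.sqrt_sq (norm_nonneg x)]
      field_simp
    obtain ⟨c, hc0, hpdφ⟩ := hφ.partialDeriv_eq n x hx0
    -- Both gradients are nonnegative multiples of `x`, so the cross term has the good sign.
    have hsum : 0 ≤ ∑ i, partialDeriv i ψ x * partialDeriv i (φ n) x := by
      refine Finset.sum_nonneg fun i _ => ?_
      rw [hpdψ, hpdφ]
      have : x i / ‖x‖ * (c * x i) = c * (x i) ^ 2 / ‖x‖ := by ring
      rw [this]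
      positivity
    have := mul_nonneg (hψ0 x) (hφ.laplacian_nonneg n x hx0)
    rw [laplacianMul, hlapψ]
    linarith
  set B : Set (EuclideanSpace ℝ (Fin N)) := ball 0 δ with hB
  have hBp : ∀ x ∈ B, x ≠ 0 → x ∈ punctured Ω := fun x hx hx0 =>
    ⟨hball (ball_subset_closedBall (ball_subset_ball (by linarith) hx)), hx0⟩
  set w : EuclideanSpace ℝ (Fin N) → ℝ := fun x => (N - 1) * ‖x‖⁻¹ * u x + (1 + ‖x‖) * -v x with hw
  have hne := ae_ne_zero_euclideanSpace hN
  have hw0 : ∀ᵐ x ∂(volume.restrict B), 0 ≤ w x := by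
    refine (ae_restrict_iff' measurableSet_ball).2 ?_
    filter_upwards [hu0, hv0, hne] with x h1 h2 h3 hx
    have h4 := h1 (hBp x hx h3)
    have h5 := h2 (hBp x hx h3)
    have : (0 : ℝ) ≤ N - 1 := by linarith
    simp only [hw]
    positivity
  have hMu : IntegrableOn (fun x => M * |u x|) A :=
    ((hu.mono_set hAΩ).integrableOn_isCompact hAc).abs.const_mul M
  set R : ℝ := ∫ x in A, M * |u x| with hR
  -- uniform integral bound
  have hbound : ∀ n, ∫⁻ x in B, ENNReal.ofReal (φ n x * w x) ≤ ENNReal.ofReal R := by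
    intro n
    obtain ⟨hi1, hi2, heq⟩ := barrier_test hφ hu hv h hψ hc hs n
    set J : EuclideanSpace ℝ (Fin N) → ℝ :=
      fun x => laplacianMul ψ (φ n) x * u x - ψ x * φ n x * v x with hJ
    have hJi : Integrable J := hi1.sub hi2
    have hJ0 : ∫ x, J x = 0 := by
      rw [hJ, integral_sub hi1 hi2, heq, sub_self]
    have hle : ∀ᵐ x ∂(volume.restrict B), φ n x * w x ≤ J x := by
      refine (ae_restrict_iff' measurableSet_ball).2 ?_
      filter_upwards [hu0, hne] with x h1 h3 hx
      have h4 := h1 (hBp x hx h3)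
      have h5 := mul_le_mul_of_nonneg_right (hlow x hx h3 n) h4
      have h6 : ψ x = 1 + ‖x‖ := by
        simp [hψdef, η.one_of_mem_closedBall (ball_subset_closedBall hx)]
      simp only [hJ, hw, h6]
      linarith
    have hJB0 : ∀ᵐ x ∂(volume.restrict B), 0 ≤ J x := by
      filter_upwards [hle, hw0] with x h1 h2
      exact (mul_nonneg (hφ.nonneg n x) h2).trans h1
    -- Outside the ball the term with `v` has a favourable sign and is dropped. As `J` has total
    -- integral zero, its integral over `B` equals that of `-J` outside, which only sees the region
    -- `A` away from the origin.
    have hout : ∀ᵐ x ∂(volume.restrict Bᶜ), -J x ≤ A.indicator (fun x => M * |u x|) x := by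
      refine (ae_restrict_iff' measurableSet_ball.compl).2 ?_
      filter_upwards [hv0] with x h2 hx
      by_cases hxA : x ∈ A
      · rw [indicator_of_mem hxA]
        have h3 : |laplacianMul ψ (φ n) x * u x| ≤ M * |u x| := by
          rw [abs_mul]
          exact mul_le_mul_of_nonneg_right (hM x hxA n) (abs_nonneg _)
        have h4 := mul_nonneg (mul_nonneg (hψ0 x) (hφ.nonneg n x)) (h2 (hAΩ hxA))
        have h5 := neg_abs_le (laplacianMul ψ (φ n) x * u x)
        simp only [hJ]
        linarith
      · have hxs : x ∉ tsupport ψ := fun hxs => hxA ⟨hxs, hx⟩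
        rw [indicator_of_notMem hxA]
        simp [hJ, laplacianMul, classicalLaplacian_eq_zero_of_notMem_tsupport hxs,
          image_eq_zero_of_notMem_tsupport hxs,
          partialDeriv_eq_zero_of_notMem_tsupport hxs]
    have hAm : MeasurableSet A := hAc.measurableSet
    have hAB : A ⊆ Bᶜ := fun x hx => hx.2
    have hsplit : ∫ x in B, J x = ∫ x in Bᶜ, -J x := by
      have := integral_add_compl (s := B) measurableSet_ball hJi
      rw [integral_neg]
      linarith
    have hfin : ∫ x in B, J x ≤ R := by
      rw [hsplit]
      calc ∫ x in Bᶜ, -J x ≤ ∫ x in Bᶜ, A.indicator (fun x => M * |u x|) x :=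
            integral_mono_ae hJi.neg.integrableOn
              ((integrable_indicator_iff hAm).2 hMu).integrableOn hout
        _ = R := by
            rw [setIntegral_indicator hAm, inter_eq_self_of_subset_right hAB]
    calc ∫⁻ x in B, ENNReal.ofReal (φ n x * w x) ≤ ∫⁻ x in B, ENNReal.ofReal (J x) :=
          lintegral_mono_ae (hle.mono fun x hx => ENNReal.ofReal_le_ofReal hx)
      _ = ENNReal.ofReal (∫ x in B, J x) :=
          (ofReal_integral_eq_lintegral_ofReal hJi.integrableOn hJB0).symm
      _ ≤ ENNReal.ofReal R := ENNReal.ofReal_le_ofReal hfin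
  have hrestr : volume.restrict B ≤ volume.restrict (punctured Ω : Set _) := by
    have h1 : volume.restrict B = volume.restrict (B \ {0}) := by
      refine Measure.restrict_congr_set ?_
      filter_upwards [hne] with x hx
      exact propext ⟨fun hxB => ⟨hxB, hx⟩, fun hxB => hxB.1⟩
    rw [h1]
    exact Measure.restrict_mono (fun x hx => hBp x hx.1 hx.2) le_rfl
  have hwm : AEStronglyMeasurable w (volume.restrict B) := by
    have h1 : AEStronglyMeasurable u (volume.restrict B) := hu.aestronglyMeasurable.mono_measure hrestr
    have h2 : AEStronglyMeasurable v (volume.restrict B) := hv.aestronglyMeasurable.mono_measure hrestr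
    have h3 : Measurable fun x : EuclideanSpace ℝ (Fin N) => ((N : ℝ) - 1) * ‖x‖⁻¹ := by fun_prop
    have h4 : Measurable fun x : EuclideanSpace ℝ (Fin N) => 1 + ‖x‖ := by fun_prop
    exact (h3.aestronglyMeasurable.mul h1).add (h4.aestronglyMeasurable.mul h2.neg)
  refine ⟨hwm, ?_⟩
  rw [hasFiniteIntegral_iff_ofReal hw0]
  -- Since `φ n → 1` almost everywhere, Fatou's lemma transfers the uniform bound to `w`.
  have hlim : ∀ᵐ x ∂(volume.restrict B), ENNReal.ofReal (w x) =
      liminf (fun n => ENNReal.ofReal (φ n x * w x)) atTop := by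
    filter_upwards [ae_restrict_of_ae hne] with x hx
    have := ((hφ.tendsto x hx).mul_const (w x))
    rw [one_mul] at this
    exact ((ENNReal.continuous_ofReal.tendsto _).comp this).liminf_eq.symm
  rw [lintegral_congr_ae hlim]
  refine (lintegral_liminf_le' fun n => ?_).trans_lt ?_
  · exact (((hφ.contDiff n).continuous.aestronglyMeasurable).mul hwm).aemeasurable.ennreal_ofReal
  · refine lt_of_le_of_lt ?_ (ENNReal.ofReal_lt_top (r := R))
    exact (liminf_le_liminf (Eventually.of_forall hbound)).trans (by simp)

end RemovableSingularity

/-! ### The Brezis–Lions lemma. -/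

section BrezisLions

variable {N : ℕ} {Ω : Opens (EuclideanSpace ℝ (Fin N))} {u v : EuclideanSpace ℝ (Fin N) → ℝ}
  {φ : ℕ → EuclideanSpace ℝ (Fin N) → ℝ} {C : ℝ} {ψ : EuclideanSpace ℝ (Fin N) → ℝ}

theorem punctured_subset (Ω : Opens (EuclideanSpace ℝ (Fin N))) :
    (punctured Ω : Set (EuclideanSpace ℝ (Fin N))) ⊆ Ω := fun _ hx => hx.1

theorem MeasureTheory.LocallyIntegrableOn.of_punctured {f : EuclideanSpace ℝ (Fin N) → ℝ} {δ : ℝ} (hδ : 0 < δ)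
    (hf : LocallyIntegrableOn f (punctured Ω)) (hb : IntegrableOn f (ball 0 δ)) :
    LocallyIntegrableOn f Ω := by
  intro x hx
  rcases eq_or_ne x 0 with rfl | h
  · exact ⟨ball 0 δ, mem_nhdsWithin_of_mem_nhds (ball_mem_nhds _ hδ), hb⟩
  · have hxp : x ∈ (punctured Ω : Set (EuclideanSpace ℝ (Fin N))) := ⟨hx, h⟩
    have := hf x hxp
    rwa [(punctured Ω).isOpen.nhdsWithin_eq hxp, ← Ω.isOpen.nhdsWithin_eq hx] at this

/-- Passing to the limit in the product test against the barriers. -/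
theorem tendsto_integral_mul_laplacian_barrier (hN : 1 ≤ N) (hφ : IsBarrierSequence φ C)
    (hu : LocallyIntegrableOn u Ω) (hv : LocallyIntegrableOn v Ω)
    (hw : LocallyIntegrableOn (fun x => ‖x‖⁻¹ * u x) Ω)
    (h : distribLaplacian (regularDistribution (punctured Ω) u) =
      regularDistribution (punctured Ω) v)
    (hψ : ContDiff ℝ ∞ ψ) (hc : HasCompactSupport ψ) (hs : tsupport ψ ⊆ Ω) :
    Tendsto (fun n => ∫ x, ψ x * classicalLaplacian (φ n) x * u x) atTop
      (𝓝 ((∫ x, ψ x * v x) - ∫ x, classicalLaplacian ψ x * u x)) := by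
  have hne := ae_ne_zero_euclideanSpace hN
  have hlap0 : ∀ x ∉ tsupport ψ, classicalLaplacian ψ x = 0 := fun x hx =>
    classicalLaplacian_eq_zero_of_notMem_tsupport hx
  have hpd0 : ∀ x ∉ tsupport ψ, ∀ i, partialDeriv i ψ x = 0 := fun x hx =>
    partialDeriv_eq_zero_of_notMem_tsupport hx
  have hψ0 : ∀ x ∉ tsupport ψ, ψ x = 0 := fun x hx => image_eq_zero_of_notMem_tsupport hx
  have hi1 : ∀ n, Integrable fun x => classicalLaplacian ψ x * φ n x * u x := fun n =>
    hu.integrable_continuousOn_mul hc hs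
      (hψ.continuous_classicalLaplacian.mul (hφ.contDiff n).continuous).continuousOn
      fun x hx => by simp [hlap0 x hx]
  have hi2 : ∀ n, Integrable fun x =>
      2 * (∑ i, partialDeriv i ψ x * partialDeriv i (φ n) x) * u x := fun n =>
    hu.integrable_continuousOn_mul hc hs
      (continuous_const.mul (continuous_finsetSum _ fun i _ =>
        (hψ.continuous_partialDeriv i).mul ((hφ.contDiff n).continuous_partialDeriv i))).continuousOn
      fun x hx => by simp [hpd0 x hx]
  have hi3 : ∀ n, Integrable fun x => ψ x * classicalLaplacian (φ n) x * u x := fun n =>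
    hu.integrable_continuousOn_mul hc hs
      (hψ.continuous.mul (hφ.contDiff n).continuous_classicalLaplacian).continuousOn
      fun x hx => by simp [hψ0 x hx]
  have hi4 : ∀ n, Integrable fun x => ψ x * φ n x * v x := fun n =>
    hv.integrable_continuousOn_mul hc hs
      (hψ.continuous.mul (hφ.contDiff n).continuous).continuousOn
      fun x hx => by simp [hψ0 x hx]
  have hL1 : Tendsto (fun n => ∫ x, classicalLaplacian ψ x * φ n x * u x) atTop
      (𝓝 (∫ x, classicalLaplacian ψ x * u x)) := by
    refine tendsto_integral_of_dominated_convergence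
      (fun x => |classicalLaplacian ψ x * u x|) (fun n => (hi1 n).aestronglyMeasurable)
      (hu.integrable_continuousOn_mul hc hs hψ.continuous_classicalLaplacian.continuousOn hlap0).abs
      (fun n => Eventually.of_forall fun x => ?_) (hne.mono fun x hx => ?_)
    · rw [Real.norm_eq_abs, mul_right_comm, abs_mul, abs_of_nonneg (hφ.nonneg n x)]
      exact mul_le_of_le_one_right (abs_nonneg _) (hφ.le_one n x)
    · simpa using ((hφ.tendsto x hx).const_mul (classicalLaplacian ψ x)).mul_const (u x)
  have hL4 : Tendsto (fun n => ∫ x, ψ x * φ n x * v x) atTop (𝓝 (∫ x, ψ x * v x)) := by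
    refine tendsto_integral_of_dominated_convergence
      (fun x => |ψ x * v x|) (fun n => (hi4 n).aestronglyMeasurable)
      (hv.integrable_continuousOn_mul hc hs hψ.continuous.continuousOn hψ0).abs
      (fun n => Eventually.of_forall fun x => ?_) (hne.mono fun x hx => ?_)
    · rw [Real.norm_eq_abs, mul_right_comm, abs_mul, abs_of_nonneg (hφ.nonneg n x)]
      exact mul_le_of_le_one_right (abs_nonneg _) (hφ.le_one n x)
    · simpa using ((hφ.tendsto x hx).const_mul (ψ x)).mul_const (v x)
  have hL2 : Tendsto (fun n => ∫ x, 2 * (∑ i, partialDeriv i ψ x * partialDeriv i (φ n) x) * u x)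
      atTop (𝓝 0) := by
    -- The gradient of `φ n` is only bounded by `C / ‖x‖`, so dominating the cross term takes
    -- integrability of `u / ‖x‖`.
    have hbi : Integrable fun x => (2 * ∑ i, |partialDeriv i ψ x| * C) * (‖x‖⁻¹ * u x) :=
      hw.integrable_continuousOn_mul hc hs
        (continuous_const.mul (continuous_finsetSum _ fun i _ =>
          ((hψ.continuous_partialDeriv i).abs.mul continuous_const))).continuousOn
        fun x hx => by simp [hpd0 x hx]
    rw [← integral_zero (EuclideanSpace ℝ (Fin N)) ℝ (μ := volume)]
    refine tendsto_integral_of_dominated_convergence _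
      (fun n => (hi2 n).aestronglyMeasurable) hbi.norm
      (fun n => hne.mono fun x hx => ?_) (hne.mono fun x hx => ?_)
    · rw [norm_mul, norm_mul _ (‖x‖⁻¹ * u x), norm_mul ‖x‖⁻¹, ← mul_assoc]
      gcongr
      have hC : 0 ≤ C / ‖x‖ ^ 2 := (hφ.laplacian_nonneg 0 x hx).trans (hφ.laplacian_le 0 x hx)
      have hC' : 0 ≤ C := by
        have := mul_nonneg hC (sq_nonneg ‖x‖)
        have hx' : ‖x‖ ≠ 0 := norm_ne_zero_iff.2 hx
        rwa [div_mul_cancel₀ _ (pow_ne_zero 2 hx')] at this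
      rw [Real.norm_eq_abs, Real.norm_eq_abs, Real.norm_eq_abs, abs_inv, abs_norm, abs_mul, abs_mul,
        abs_two, mul_assoc, abs_of_nonneg (a := ∑ i, |partialDeriv i ψ x| * C)
          (Finset.sum_nonneg fun i _ => by positivity), Finset.sum_mul]
      gcongr
      refine (Finset.abs_sum_le_sum_abs _ _).trans (Finset.sum_le_sum fun i _ => ?_)
      rw [abs_mul, mul_assoc]
      gcongr
      rw [← div_eq_mul_inv]
      exact hφ.abs_partialDeriv_le n x hx i
    · have : Tendsto (fun n => 2 * (∑ i, partialDeriv i ψ x * partialDeriv i (φ n) x) * u x) atTop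
          (𝓝 (2 * (∑ i, partialDeriv i ψ x * 0) * u x)) :=
        ((tendsto_finsetSum _ fun i _ => (hφ.tendsto_partialDeriv x hx i).const_mul _).const_mul
          2).mul_const _
      simpa using this
  have heq : ∀ n, ∫ x, ψ x * classicalLaplacian (φ n) x * u x =
      (∫ x, ψ x * φ n x * v x) - (∫ x, classicalLaplacian ψ x * φ n x * u x) -
        ∫ x, 2 * (∑ i, partialDeriv i ψ x * partialDeriv i (φ n) x) * u x := by
    intro n
    have h1 := (barrier_test hφ (hu.mono_set (punctured_subset Ω))
      (hv.mono_set (punctured_subset Ω)) h hψ.contDiffOn hc hs n).2.2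
    simp only [laplacianMul, add_mul] at h1
    rw [integral_add (by exact (hi1 n).add (hi2 n)) (hi3 n), integral_add (hi1 n) (hi2 n)] at h1
    linarith
  simp only [heq]
  simpa using (hL4.sub hL1).sub hL2

/-- **Brezis–Lions lemma** (in dimension at least four): a nonnegative function that is
superharmonic off the origin extends through the origin, up to a nonnegative Dirac mass. -/
theorem brezis_lions (hN : 4 ≤ N) (h0 : (0 : EuclideanSpace ℝ (Fin N)) ∈ Ω)
    (hu : LocallyIntegrableOn u (punctured Ω)) (hv : LocallyIntegrableOn v (punctured Ω))
    (h : distribLaplacian (regularDistribution (punctured Ω) u) =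
      regularDistribution (punctured Ω) v)
    (hu0 : ∀ᵐ x, x ∈ punctured Ω → 0 ≤ u x) (hv0 : ∀ᵐ x, x ∈ punctured Ω → 0 ≤ -v x) :
    LocallyIntegrableOn u Ω ∧ LocallyIntegrableOn v Ω ∧ ∃ β : ℝ, 0 ≤ β ∧
      distribLaplacian (regularDistribution Ω u) =
        regularDistribution Ω v - β • (Distribution.delta 0 : 𝓓'(Ω, ℝ)) := by
  have hN1 : 1 ≤ N := by omega
  have hNr : (4 : ℝ) ≤ N := by exact_mod_cast hN
  obtain ⟨φ, C, hC, hφ⟩ := exists_isBarrierSequence hN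
  have hne := ae_ne_zero_euclideanSpace hN1
  obtain ⟨ε, hε, hεΩ⟩ := Metric.isOpen_iff.1 Ω.isOpen 0 h0
  set δ := ε / 3 with hδdef
  have hδ : 0 < δ := by positivity
  have hball : closedBall (0 : EuclideanSpace ℝ (Fin N)) (2 * δ) ⊆ Ω :=
    (closedBall_subset_ball (by linarith)).trans hεΩ
  have hint := integrableOn_ball_of_laplacian_nonpos hN1 hφ hu hv h hu0 hv0 hδ hball
  set B : Set (EuclideanSpace ℝ (Fin N)) := ball 0 δ with hB
  have hBp : ∀ x ∈ B, x ≠ 0 → x ∈ punctured Ω := fun x hx hx0 =>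
    ⟨hball (ball_subset_closedBall (ball_subset_ball (by linarith) hx)), hx0⟩
  have hrestr : volume.restrict B ≤ volume.restrict (punctured Ω : Set _) := by
    have h1 : volume.restrict B = volume.restrict (B \ {0}) := by
      refine Measure.restrict_congr_set ?_
      filter_upwards [hne] with x hx
      exact propext ⟨fun hxB => ⟨hxB, hx⟩, fun hxB => hxB.1⟩
    rw [h1]
    exact Measure.restrict_mono (fun x hx => hBp x hx.1 hx.2) le_rfl
  have hum : AEStronglyMeasurable u (volume.restrict B) := hu.aestronglyMeasurable.mono_measure hrestr
  have hvm : AEStronglyMeasurable v (volume.restrict B) := hv.aestronglyMeasurable.mono_measure hrestr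
  have hinv : Measurable fun x : EuclideanSpace ℝ (Fin N) => ‖x‖⁻¹ := by fun_prop
  have hvB : IntegrableOn v B := by
    refine Integrable.mono' hint hvm ((ae_restrict_iff' measurableSet_ball).2 ?_)
    filter_upwards [hu0, hv0, hne] with x h1 h2 h3 hx
    have h4 := h1 (hBp x hx h3)
    have h5 := h2 (hBp x hx h3)
    rw [Real.norm_eq_abs, abs_of_nonpos (by linarith)]
    have h6 : 0 ≤ ((N : ℝ) - 1) * ‖x‖⁻¹ * u x :=
      mul_nonneg (mul_nonneg (by linarith) (by positivity)) h4
    have h7 : 0 ≤ ‖x‖ * -v x := mul_nonneg (norm_nonneg x) h5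
    linarith
  have hwB : IntegrableOn (fun x => ‖x‖⁻¹ * u x) B := by
    refine Integrable.mono' hint (hinv.aestronglyMeasurable.mul hum)
      ((ae_restrict_iff' measurableSet_ball).2 ?_)
    filter_upwards [hu0, hv0, hne] with x h1 h2 h3 hx
    have h4 := h1 (hBp x hx h3)
    have h5 := h2 (hBp x hx h3)
    have h6 : 0 ≤ ‖x‖⁻¹ * u x := by positivity
    rw [Real.norm_eq_abs, abs_of_nonneg h6]
    have h7 : 0 ≤ (1 + ‖x‖) * -v x := mul_nonneg (by positivity) h5
    nlinarith
  have huB : IntegrableOn u B := by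
    refine Integrable.mono' (hwB.const_mul δ) hum ((ae_restrict_iff' measurableSet_ball).2 ?_)
    filter_upwards [hu0, hne] with x h1 h3 hx
    have h4 := h1 (hBp x hx h3)
    have h5 : 0 < ‖x‖ := norm_pos_iff.2 h3
    have h6 : ‖x‖ < δ := mem_ball_zero_iff.1 hx
    rw [Real.norm_eq_abs, abs_of_nonneg h4]
    calc u x = ‖x‖ * (‖x‖⁻¹ * u x) := by field_simp
      _ ≤ δ * (‖x‖⁻¹ * u x) := by gcongr
  have hw : LocallyIntegrableOn (fun x => ‖x‖⁻¹ * u x) (punctured Ω) :=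
    hu.continuousOn_mul (continuous_norm.continuousOn.inv₀ fun x hx => norm_ne_zero_iff.2 hx.2)
      (punctured Ω).isOpen.isLocallyClosed
  have huΩ := hu.of_punctured hδ huB
  have hvΩ := hv.of_punctured hδ hvB
  have hwΩ := LocallyIntegrableOn.of_punctured hδ hw hwB
  have hu0' : ∀ᵐ x, x ∈ Ω → 0 ≤ u x := by
    filter_upwards [hu0, hne] with x h1 h2 hx using h1 ⟨hx, h2⟩
  -- `S` is the defect of the equation at the origin. Positivity and vanishing on test functions
  -- with `χ 0 = 0` identify it as a nonnegative multiple of `δ₀`.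
  set S : 𝓓'(Ω, ℝ) := regularDistribution Ω v - distribLaplacian (regularDistribution Ω u) with hS
  have hSapply : ∀ χ : 𝓓(Ω, ℝ), S χ = (∫ x, χ x * v x) - ∫ x, classicalLaplacian χ x * u x := by
    intro χ
    have : S χ = regularDistribution Ω v χ - distribLaplacian (regularDistribution Ω u) χ := rfl
    rw [this, regularDistribution_apply hvΩ, distribLaplacian_regularDistribution_apply huΩ]
  have hlim : ∀ χ : 𝓓(Ω, ℝ), Tendsto (fun n => ∫ x, χ x * classicalLaplacian (φ n) x * u x) atTop
      (𝓝 (S χ)) := by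
    intro χ
    rw [hSapply]
    exact tendsto_integral_mul_laplacian_barrier hN1 hφ huΩ hvΩ hwΩ h χ.contDiff
      χ.hasCompactSupport χ.tsupport_subset
  have hSnonneg : ∀ χ : 𝓓(Ω, ℝ), (∀ x, 0 ≤ χ x) → 0 ≤ S χ := by
    intro χ hχ
    refine ge_of_tendsto' (hlim χ) fun n => integral_nonneg_of_ae ?_
    filter_upwards [hu0', hne] with x h1 h2
    by_cases hx : x ∈ Ω
    · exact mul_nonneg (mul_nonneg (hχ x) (hφ.laplacian_nonneg n x h2)) (h1 hx)
    · have : χ x = 0 := image_eq_zero_of_notMem_tsupport fun hx' => hx (χ.tsupport_subset hx')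
      simp [this]
  have hSzero : ∀ χ : 𝓓(Ω, ℝ), χ 0 = 0 → S χ = 0 := by
    intro χ hχ
    -- With `χ 0 = 0`, the Lipschitz bound `|χ x| ≤ D ‖x‖` cancels one power in `Δ(φ n) ≤ C / ‖x‖ ^
    -- 2`, leaving the integrable majorant `D C |u| / ‖x‖`.
    obtain ⟨D, hD⟩ := ContDiff.lipschitzWith_of_hasCompactSupport χ.hasCompactSupport χ.contDiff
      (by simp)
    have hχ0 : ∀ x ∉ tsupport χ, χ x = 0 := fun x hx => image_eq_zero_of_notMem_tsupport hx
    have hbi : Integrable fun x =>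
        (tsupport χ).indicator (fun _ => (D : ℝ) * C) x * (‖x‖⁻¹ * u x) := by
      refine hwΩ.integrable_continuousOn_mul χ.hasCompactSupport χ.tsupport_subset ?_
        fun x hx => indicator_of_notMem hx _
      exact continuousOn_const.congr fun x hx => indicator_of_mem hx _
    refine tendsto_nhds_unique (hlim χ) ?_
    rw [← integral_zero (EuclideanSpace ℝ (Fin N)) ℝ (μ := volume)]
    refine tendsto_integral_of_dominated_convergence _ (fun n => ?_) hbi.norm
      (fun n => hne.mono fun x hx => ?_) (hne.mono fun x hx => ?_)
    · exact (huΩ.integrable_continuousOn_mul χ.hasCompactSupport χ.tsupport_subset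
        (χ.continuous.mul (hφ.contDiff n).continuous_classicalLaplacian).continuousOn
        fun x hx => by simp [hχ0 x hx]).aestronglyMeasurable
    · by_cases hxs : x ∈ tsupport χ
      · have hx' : 0 < ‖x‖ := norm_pos_iff.2 hx
        have h1 : ‖χ x‖ ≤ D * ‖x‖ := by simpa [hχ] using hD.dist_le_mul x 0
        rw [indicator_of_mem hxs, norm_mul, norm_mul, norm_mul _ (‖x‖⁻¹ * u x), norm_mul ‖x‖⁻¹,
          Real.norm_of_nonneg (hφ.laplacian_nonneg n x hx), norm_inv, norm_norm,
          Real.norm_of_nonneg (by positivity : 0 ≤ (D : ℝ) * C)]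
        calc ‖χ x‖ * classicalLaplacian (φ n) x * ‖u x‖
            ≤ (D * ‖x‖) * (C / ‖x‖ ^ 2) * ‖u x‖ := by
              gcongr
              · exact hφ.laplacian_nonneg n x hx
              · exact hφ.laplacian_le n x hx
          _ = D * C * (‖x‖⁻¹ * ‖u x‖) := by
              field_simp
      · rw [hχ0 x hxs, zero_mul, zero_mul, norm_zero]
        exact norm_nonneg _
    · simpa using ((hφ.tendsto_laplacian x hx).const_mul (χ x)).mul_const (u x)
  let b : ContDiffBump (0 : EuclideanSpace ℝ (Fin N)) := ⟨δ, 2 * δ, hδ, by linarith⟩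
  let η : 𝓓(Ω, ℝ) := ⟨b, b.contDiff, b.hasCompactSupport, b.tsupport_eq.trans_subset hball⟩
  have hη0 : η 0 = 1 := b.one_of_mem_closedBall (mem_closedBall_self hδ.le)
  refine ⟨huΩ, hvΩ, S η, hSnonneg η fun x => b.nonneg, ?_⟩
  ext χ
  -- Subtracting `χ 0 • η` makes the test function vanish at `0`, whence `S χ = χ 0 * S η` and `β =
  -- S η`.
  have h1 : S (χ - χ 0 • η) = 0 := hSzero _ (by simp [hη0])
  rw [map_sub, map_smul, smul_eq_mul] at h1
  have h2 : S χ = regularDistribution Ω v χ - distribLaplacian (regularDistribution Ω u) χ := rfl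
  change distribLaplacian (regularDistribution Ω u) χ = regularDistribution Ω v χ - S η * χ 0
  linarith

end BrezisLions

/-! ### Weak-type bound for Newtonian potentials. -/

section WeakTypeEstimate

variable {N : ℕ}

/-- The kernel `‖z‖ ^ (2 - N)`, with value `∞` at the origin. -/
noncomputable def newtonKernel (N : ℕ) (z : EuclideanSpace ℝ (Fin N)) : ENNReal :=
  (‖z‖ₑ ^ (N - 2))⁻¹

theorem measurable_newtonKernel : Measurable (newtonKernel N) :=
  (measurable_enorm.pow_const _).inv

theorem newtonKernel_sub_comm (x y : EuclideanSpace ℝ (Fin N)) :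
    newtonKernel N (x - y) = newtonKernel N (y - x) := by
  simp only [newtonKernel, enorm_sub_rev]

theorem newtonKernel_eq_ofReal {z : EuclideanSpace ℝ (Fin N)} (hz : z ≠ 0) :
    newtonKernel N z = ENNReal.ofReal ((‖z‖ ^ (N - 2))⁻¹) := by
  have h : 0 < ‖z‖ := norm_pos_iff.2 hz
  rw [newtonKernel, ENNReal.ofReal_inv_of_pos (by positivity), ENNReal.ofReal_pow h.le,
    ofReal_norm]

/-- In polar coordinates the radial density is `r ^ (N - 1) * r ^ (2 - N) = r`, whose integral over
`(0, ρ)` is `ρ ^ 2 / 2`. -/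
theorem lintegral_ball_newtonKernel_le (hN : 2 ≤ N) :
    ∃ C : ℝ, 0 ≤ C ∧ ∀ ρ : ℝ, 0 < ρ →
      ∫⁻ z in ball 0 ρ, newtonKernel N z ≤ ENNReal.ofReal (C * ρ ^ 2) := by
  have hne : Nonempty (Fin N) := ⟨⟨0, by omega⟩⟩
  refine ⟨N * volume.real (ball (0 : EuclideanSpace ℝ (Fin N)) 1), by positivity, fun ρ hρ => ?_⟩
  have hfin : Module.finrank ℝ (EuclideanSpace ℝ (Fin N)) = N := by simp
  set f : ℝ → ℝ := fun y => (y ^ (N - 2))⁻¹ with hf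
  have hmul : ∀ y : ℝ, 0 < y → y ^ (N - 1) * (y ^ (N - 2))⁻¹ = y := by
    intro y hy
    rw [show N - 1 = (N - 2) + 1 by omega, pow_succ]
    field_simp
  have hint : IntegrableOn (fun z : EuclideanSpace ℝ (Fin N) => f ‖z‖) (ball 0 ρ) := by
    rw [integrableOn_fun_norm_addHaar volume, hfin]
    have : IntegrableOn (fun y : ℝ => y) (Ioo 0 ρ) :=
      continuous_id.integrableOn_Icc.mono_set Ioo_subset_Icc_self
    refine this.congr_fun (fun y hy => ?_) measurableSet_Ioo
    exact (hmul y hy.1).symm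
  have hval : ∫ z in ball (0 : EuclideanSpace ℝ (Fin N)) ρ, f ‖z‖ =
      N * volume.real (ball (0 : EuclideanSpace ℝ (Fin N)) 1) * (ρ ^ 2 / 2) := by
    have h1 : ∫ z in ball (0 : EuclideanSpace ℝ (Fin N)) ρ, f ‖z‖ =
        ∫ z : EuclideanSpace ℝ (Fin N), (Iio ρ).indicator f ‖z‖ := by
      rw [← integral_indicator measurableSet_ball]
      congr 1
      ext z
      simp [indicator]
    have h2 : ∫ y in Ioi (0 : ℝ), y ^ (N - 1) • (Iio ρ).indicator f y = ρ ^ 2 / 2 := by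
      have h3 : ∫ y in Ioi (0 : ℝ), y ^ (N - 1) • (Iio ρ).indicator f y =
          ∫ y in Ioi (0 : ℝ), (Iio ρ).indicator (fun y => y) y := by
        refine setIntegral_congr_fun measurableSet_Ioi fun y hy => ?_
        by_cases hyρ : y < ρ
        · simp [hyρ, hf, hmul y hy]
        · simp [hyρ]
      rw [h3, setIntegral_indicator measurableSet_Iio, Ioi_inter_Iio,
        ← integral_Ioc_eq_integral_Ioo, ← intervalIntegral.integral_of_le hρ.le, integral_id]
      ring
    rw [h1, integral_fun_norm_addHaar, hfin, h2]
    simp [mul_assoc]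
  have hpos : ∀ z : EuclideanSpace ℝ (Fin N), 0 ≤ f ‖z‖ := fun z => by positivity
  calc ∫⁻ z in ball 0 ρ, newtonKernel N z
      = ∫⁻ z in ball (0 : EuclideanSpace ℝ (Fin N)) ρ, ENNReal.ofReal (f ‖z‖) := by
        refine lintegral_congr_ae (ae_restrict_of_ae ?_)
        filter_upwards [ae_ne_zero_euclideanSpace (by omega : 1 ≤ N)] with z hz
        exact newtonKernel_eq_ofReal hz
    _ = ENNReal.ofReal (∫ z in ball (0 : EuclideanSpace ℝ (Fin N)) ρ, f ‖z‖) :=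
        (ofReal_integral_eq_lintegral_ofReal hint (Eventually.of_forall hpos)).symm
    _ ≤ _ := by
        rw [hval]
        gcongr
        nlinarith [sq_nonneg ρ]

/-- Off a ball around `x` the kernel is bounded, which bounds its integral over any set. -/
theorem lintegral_newtonKernel_le {C : ℝ}
    (hC : ∀ ρ : ℝ, 0 < ρ → ∫⁻ z in ball 0 ρ, newtonKernel N z ≤ ENNReal.ofReal (C * ρ ^ 2))
    (x : EuclideanSpace ℝ (Fin N)) {A : Set (EuclideanSpace ℝ (Fin N))}
    {ρ : ℝ} (hρ : 0 < ρ) :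
    ∫⁻ y in A, newtonKernel N (x - y) ≤
      ENNReal.ofReal (C * ρ ^ 2) + ENNReal.ofReal ((ρ ^ (N - 2))⁻¹) * volume A := by
  have hpt : ∀ y, newtonKernel N (x - y) ≤
      (ball 0 ρ).indicator (newtonKernel N) (y - x) + ENNReal.ofReal ((ρ ^ (N - 2))⁻¹) := by
    intro y
    rw [newtonKernel_sub_comm]
    by_cases hy : y - x ∈ ball (0 : EuclideanSpace ℝ (Fin N)) ρ
    · rw [indicator_of_mem hy]
      exact le_self_add
    · rw [indicator_of_notMem hy, zero_add]
      have h1 : ρ ≤ ‖y - x‖ := by simpa using hy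
      rw [newtonKernel_eq_ofReal (norm_pos_iff.1 (hρ.trans_le h1))]
      gcongr
  calc ∫⁻ y in A, newtonKernel N (x - y)
      ≤ ∫⁻ y in A, ((ball 0 ρ).indicator (newtonKernel N) (y - x) +
          ENNReal.ofReal ((ρ ^ (N - 2))⁻¹)) := lintegral_mono hpt
    _ = (∫⁻ y in A, (ball 0 ρ).indicator (newtonKernel N) (y - x)) +
          ENNReal.ofReal ((ρ ^ (N - 2))⁻¹) * volume A := by
        rw [lintegral_add_right _ measurable_const, setLIntegral_const]
    _ ≤ (∫⁻ y, (ball 0 ρ).indicator (newtonKernel N) (y - x)) +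
          ENNReal.ofReal ((ρ ^ (N - 2))⁻¹) * volume A := by
        gcongr
        exact Measure.restrict_le_self
    _ ≤ _ := by
        gcongr
        rw [lintegral_sub_right_eq_self (fun z => (ball 0 ρ).indicator (newtonKernel N) z) x,
          lintegral_indicator measurableSet_ball]
        exact hC ρ hρ

theorem measurable_lintegral_newtonKernel (μ : Measure (EuclideanSpace ℝ (Fin N))) [SFinite μ] :
    Measurable fun y => ∫⁻ x, newtonKernel N (x - y) ∂μ :=
  (measurable_newtonKernel.comp (measurable_snd.sub measurable_fst)).lintegral_prod_right'

/-- Newtonian potentials of finite measures belong to the weak space `L ^ (N / (N - 2))`. -/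
theorem volume_lt_newtonPotential_le (hN : 3 ≤ N) (μ : Measure (EuclideanSpace ℝ (Fin N)))
    [IsFiniteMeasure μ] :
    ∃ C : ℝ≥0, ∀ K : Set (EuclideanSpace ℝ (Fin N)), MeasurableSet K → volume K ≠ ⊤ →
      ∀ t : ℝ, 0 < t →
      volume ({y | ENNReal.ofReal t < ∫⁻ x, newtonKernel N (x - y) ∂μ} ∩ K) ≤
        ENNReal.ofReal (C / t ^ ((N : ℝ) / ((N : ℝ) - 2))) := by
  obtain ⟨C₀, hC₀, hC⟩ := lintegral_ball_newtonKernel_le (by omega : 2 ≤ N)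
  have hNr : (3 : ℝ) ≤ N := by exact_mod_cast hN
  -- The `+ 1` keeps `M`, and hence the radius `ρ` below, positive when `μ = 0`.
  set M : ℝ := μ.real univ + 1 with hM
  have hM0 : 0 < M := by positivity
  have hμM : μ univ ≤ ENNReal.ofReal M := by
    rw [← ENNReal.ofReal_toReal (measure_ne_top μ univ)]
    exact ENNReal.ofReal_le_ofReal (by simp [hM, Measure.real])
  have hcast : ((N - 2 : ℕ) : ℝ) = N - 2 := by
    rw [Nat.cast_sub (by omega)]
    norm_num
  refine ⟨⟨2 * M * C₀ * (2 * M) ^ (2 / ((N : ℝ) - 2)), by positivity⟩, fun K hK hKfin t ht => ?_⟩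
  set A := {y | ENNReal.ofReal t < ∫⁻ x, newtonKernel N (x - y) ∂μ} ∩ K with hA
  have hAfin : volume A ≠ ⊤ := measure_ne_top_of_subset inter_subset_right hKfin
  -- Integrating the potential over `A` and using Tonelli gives `t |A| ≤ M (C₀ ρ ^ 2 + ρ ^ (2 - N)
  -- |A|)`. With `ρ ^ (N - 2) = 2 M / t` the last term is `t |A| / 2` and is absorbed on the left;
  -- this uses `|A| < ∞`, hence the intersection with `K`.
  set ρ : ℝ := (2 * M / t) ^ (1 / ((N : ℝ) - 2)) with hρdef
  have hρ : 0 < ρ := by positivity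
  have hρpow : ρ ^ (N - 2) = 2 * M / t := by
    rw [hρdef, ← Real.rpow_natCast, ← Real.rpow_mul (by positivity), hcast,
      one_div_mul_cancel (by linarith), Real.rpow_one]
  have hρsq : ρ ^ 2 = (2 * M / t) ^ (2 / ((N : ℝ) - 2)) := by
    rw [hρdef, ← Real.rpow_natCast, ← Real.rpow_mul (by positivity)]
    congr 1
    push_cast
    ring
  have hmeas : MeasurableSet A :=
    (measurableSet_lt measurable_const (measurable_lintegral_newtonKernel μ)).inter hK
  have hswap : AEMeasurable (Function.uncurry fun y x => newtonKernel N (x - y))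
      ((volume.restrict A).prod μ) :=
    (measurable_newtonKernel.comp (measurable_snd.sub measurable_fst)).aemeasurable
  have hmain : ENNReal.ofReal t * volume A ≤
      (ENNReal.ofReal (C₀ * ρ ^ 2) + ENNReal.ofReal ((ρ ^ (N - 2))⁻¹) * volume A) *
        ENNReal.ofReal M := by
    calc ENNReal.ofReal t * volume A = ∫⁻ _ in A, ENNReal.ofReal t := (setLIntegral_const _ _).symm
      _ ≤ ∫⁻ y in A, ∫⁻ x, newtonKernel N (x - y) ∂μ :=
          setLIntegral_mono' hmeas fun y hy => hy.1.le
      _ = ∫⁻ x, (∫⁻ y in A, newtonKernel N (x - y)) ∂μ :=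
          lintegral_lintegral_swap hswap
      _ ≤ ∫⁻ _, (ENNReal.ofReal (C₀ * ρ ^ 2) +
            ENNReal.ofReal ((ρ ^ (N - 2))⁻¹) * volume A) ∂μ :=
          lintegral_mono fun x => lintegral_newtonKernel_le hC x (A := A) hρ
      _ ≤ _ := by
          rw [lintegral_const]
          gcongr
  set a : ℝ := (volume A).toReal with ha
  have ha0 : 0 ≤ a := ENNReal.toReal_nonneg
  have hreal : t * a ≤ (C₀ * ρ ^ 2 + (ρ ^ (N - 2))⁻¹ * a) * M := by
    rw [← ENNReal.ofReal_toReal hAfin, ← ha, ← ENNReal.ofReal_mul ht.le,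
      ← ENNReal.ofReal_mul (by positivity), ← ENNReal.ofReal_add (by positivity) (by positivity),
      ← ENNReal.ofReal_mul (by positivity)] at hmain
    exact (ENNReal.ofReal_le_ofReal_iff (by positivity)).1 hmain
  have hexp : t ^ ((N : ℝ) / ((N : ℝ) - 2)) = t * t ^ (2 / ((N : ℝ) - 2)) := by
    have h2 : (N : ℝ) - 2 ≠ 0 := by linarith
    rw [show (N : ℝ) / ((N : ℝ) - 2) = 1 + 2 / ((N : ℝ) - 2) by field_simp; ring,
      Real.rpow_add ht, Real.rpow_one]
  rw [← ENNReal.ofReal_toReal hAfin, ← ha]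
  refine ENNReal.ofReal_le_ofReal ?_
  show a ≤ 2 * M * C₀ * (2 * M) ^ (2 / ((N : ℝ) - 2)) / t ^ ((N : ℝ) / ((N : ℝ) - 2))
  have h1 : t * a ≤ 2 * M * C₀ * ρ ^ 2 := by
    rw [hρpow] at hreal
    have h2 : (C₀ * ρ ^ 2 + (2 * M / t)⁻¹ * a) * M = M * C₀ * ρ ^ 2 + t * a / 2 := by
      field_simp
    linarith
  rw [hρsq, Real.div_rpow (by positivity) ht.le] at h1
  rw [hexp, ← div_div, le_div_iff₀ (by positivity)]
  have hp : 0 < t ^ (2 / ((N : ℝ) - 2)) := by positivity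
  rw [le_div_iff₀ ht]
  calc a * t ^ (2 / ((N : ℝ) - 2)) * t = t * a * t ^ (2 / ((N : ℝ) - 2)) := by ring
    _ ≤ 2 * M * C₀ * ((2 * M) ^ (2 / ((N : ℝ) - 2)) / t ^ (2 / ((N : ℝ) - 2))) *
        t ^ (2 / ((N : ℝ) - 2)) := by gcongr
    _ = _ := by field_simp

end WeakTypeEstimate

/-! ### Domination of `u` by a Newtonian potential. -/

section PointwiseBound

variable {N : ℕ} {Ω : Opens (EuclideanSpace ℝ (Fin N))} {u v : EuclideanSpace ℝ (Fin N) → ℝ}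

/-- Smooth compactly supported approximations from below of the kernel `‖z‖ ^ (2 - N)`, whose
Laplacian is very negative on a small ball and bounded above elsewhere. -/
theorem exists_truncated_newtonKernel (hN : 3 ≤ N) {δ : ℝ} (hδ : 0 < δ) :
    ∃ c M : ℝ, 0 < c ∧ 0 ≤ M ∧ ∀ ρ : ℝ, 0 < ρ → ρ < δ / 2 →
      ∃ G : EuclideanSpace ℝ (Fin N) → ℝ, ContDiff ℝ ∞ G ∧ tsupport G ⊆ closedBall 0 δ ∧
        (∀ z, 0 ≤ G z) ∧ (∀ z ≠ 0, G z ≤ (‖z‖ ^ (N - 2))⁻¹) ∧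
        (∀ z, classicalLaplacian G z ≤ M) ∧
        ∀ z ∈ closedBall 0 ρ, classicalLaplacian G z ≤ -(c / ρ ^ N) := by
  have hNr : (3 : ℝ) ≤ N := by exact_mod_cast hN
  have hcast : ((N - 2 : ℕ) : ℝ) = N - 2 := by
    rw [Nat.cast_sub (by omega)]
    norm_num
  set m : ℝ := ((N : ℝ) - 2) / 2 with hm
  have hm0 : 0 < m := by
    rw [hm]
    linarith
  let κ : ContDiffBump (0 : EuclideanSpace ℝ (Fin N)) :=
    ⟨δ / 2, δ, by positivity, by linarith⟩
  have hκs : tsupport κ = closedBall 0 δ := κ.tsupport_eq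
  -- `P` and `Q` bound `Γ` and its partial derivatives for `δ / 2 ≤ ‖z‖ ≤ δ`, where the cutoff `κ`
  -- varies. They do not depend on `ρ`, and so neither does `M`.
  set P : ℝ := ((δ / 2) ^ 2) ^ (-m) with hP
  set Q : ℝ := 2 * δ * m * ((δ / 2) ^ 2) ^ (-m - 1) with hQ
  have hP0 : 0 < P := by positivity
  have hQ0 : 0 < Q := by positivity
  obtain ⟨M, hM⟩ : ∃ M, ∀ z ∈ closedBall (0 : EuclideanSpace ℝ (Fin N)) δ,
      |classicalLaplacian κ z| * P + 2 * ∑ i, |partialDeriv i κ z| * Q ≤ M := by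
    have hcont : Continuous fun z =>
        |classicalLaplacian κ z| * P + 2 * ∑ i, |partialDeriv i κ z| * Q :=
      (κ.contDiff.continuous_classicalLaplacian.abs.mul continuous_const).add
        (continuous_const.mul (continuous_finsetSum _ fun i _ =>
          (κ.contDiff.continuous_partialDeriv i).abs.mul continuous_const))
    obtain ⟨M, hM⟩ := (isCompact_closedBall (0 : EuclideanSpace ℝ (Fin N))
      δ).exists_bound_of_continuousOn hcont.continuousOn
    exact ⟨M, fun z hz => (le_abs_self _).trans (hM z hz)⟩
  have hM0 : 0 ≤ M := le_trans (by positivity) (hM 0 (mem_closedBall_self hδ.le))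
  -- The power of `2` comes from `‖z‖ ^ 2 + ρ ^ 2 ≤ 2 ρ ^ 2` on the small ball.
  refine ⟨2 * m * N * 2 ^ (-m - 2), M, by positivity, hM0, fun ρ hρ hρδ => ?_⟩
  have hb : 0 < ρ ^ 2 := by positivity
  -- The regularised kernel has Laplacian `-N (N - 2) ρ ^ 2 (‖z‖ ^ 2 + ρ ^ 2) ^ (-(N + 2) / 2)`:
  -- nonpositive everywhere, and of order `-ρ ^ (-N)` for `‖z‖ ≤ ρ`, like a smoothed negative Dirac
  -- mass.
  set Γ : EuclideanSpace ℝ (Fin N) → ℝ := fun z => (‖z‖ ^ 2 + ρ ^ 2) ^ (-m) with hΓ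
  have hpos : ∀ z : EuclideanSpace ℝ (Fin N), 0 < ‖z‖ ^ 2 + ρ ^ 2 := fun z => by positivity
  have hd : ∀ p : ℝ, ∀ q : ℝ, 0 < q + ρ ^ 2 →
      HasDerivAt (fun q => (q + ρ ^ 2) ^ p) (p * (q + ρ ^ 2) ^ (p - 1)) q := by
    intro p q hq
    refine (((hasDerivAt_id q).add_const (ρ ^ 2)).rpow_const (p := p)
      (Or.inl hq.ne')).congr_deriv ?_
    simp
  have hΓs : ContDiff ℝ ∞ Γ := contDiff_iff_contDiffAt.2 fun z =>
    (((contDiff_norm_sq ℝ).add contDiff_const).contDiffAt).rpow_const_of_ne (hpos z).ne'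
  have hΓ0 : ∀ z, 0 ≤ Γ z := fun z => by positivity
  have hpdΓ : ∀ z i, partialDeriv i Γ z = 2 * z i * (-m * (‖z‖ ^ 2 + ρ ^ 2) ^ (-m - 1)) :=
    fun z i => partialDeriv_comp_norm_sq (F := fun q => (q + ρ ^ 2) ^ (-m)) i (hd _ _ (hpos z))
  have hlapΓ : ∀ z, classicalLaplacian Γ z =
      -(2 * m * N * ρ ^ 2 * (‖z‖ ^ 2 + ρ ^ 2) ^ (-m - 2)) := by
    intro z
    have hev : ∀ᶠ q in 𝓝 (‖z‖ ^ 2), HasDerivAt (fun q => (q + ρ ^ 2) ^ (-m))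
        (-m * (q + ρ ^ 2) ^ (-m - 1)) q := by
      have : ∀ᶠ q in 𝓝 (‖z‖ ^ 2), 0 < q + ρ ^ 2 :=
        ((continuous_id.add continuous_const).tendsto _).eventually (eventually_gt_nhds (hpos z))
      exact this.mono fun q hq => hd _ q hq
    refine (classicalLaplacian_comp_norm_sq hev
      ((hd (-m - 1) _ (hpos z)).const_mul (-m))).trans ?_
    have e1 : (‖z‖ ^ 2 + ρ ^ 2) ^ (-m - 1) =
        (‖z‖ ^ 2 + ρ ^ 2) ^ (-m - 2) * (‖z‖ ^ 2 + ρ ^ 2) := by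
      rw [show -m - 1 = (-m - 2) + 1 by ring, Real.rpow_add_one (hpos z).ne']
    rw [show -m - 1 - 1 = -m - 2 by ring, e1]
    have e2 : (N : ℝ) = 2 * m + 2 := by
      rw [hm]
      ring
    rw [e2]
    ring
  have hΓlap0 : ∀ z, classicalLaplacian Γ z ≤ 0 := by
    intro z
    rw [hlapΓ]
    have : 0 ≤ 2 * m * N * ρ ^ 2 * (‖z‖ ^ 2 + ρ ^ 2) ^ (-m - 2) := by positivity
    linarith
  have hlapG : ∀ z, classicalLaplacian (fun z => κ z * Γ z) z = classicalLaplacian κ z * Γ z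
      + 2 * ∑ i, partialDeriv i κ z * partialDeriv i Γ z + κ z * classicalLaplacian Γ z :=
    fun z => classicalLaplacian_mul isOpen_univ κ.contDiff.contDiffOn hΓs.contDiffOn (mem_univ z)
  have hnear : ∀ z ∈ ball (0 : EuclideanSpace ℝ (Fin N)) (δ / 2),
      classicalLaplacian (fun z => κ z * Γ z) z = classicalLaplacian Γ z := by
    intro z hz
    have hev : (fun z => κ z * Γ z) =ᶠ[𝓝 z] Γ := by
      filter_upwards [isOpen_ball.mem_nhds hz] with y hy
      have h1 : κ y = 1 := κ.one_of_mem_closedBall (ball_subset_closedBall hy)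
      simp [h1]
    exact hev.classicalLaplacian.eq_of_nhds
  refine ⟨fun z => κ z * Γ z, κ.contDiff.mul hΓs, ?_, fun z => mul_nonneg κ.nonneg (hΓ0 z),
    fun z hz => ?_, fun z => ?_, fun z hz => ?_⟩
  · exact tsupport_mul_subset_left.trans hκs.subset
  · have hz0 : 0 < ‖z‖ := norm_pos_iff.2 hz
    calc κ z * Γ z ≤ Γ z := mul_le_of_le_one_left (hΓ0 z) κ.le_one
      _ ≤ (‖z‖ ^ 2) ^ (-m) :=
          Real.rpow_le_rpow_of_nonpos (by positivity) (by linarith) (by linarith)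
      _ = (‖z‖ ^ (N - 2))⁻¹ := by
          rw [Real.rpow_neg (by positivity), ← Real.rpow_natCast, ← Real.rpow_natCast,
            ← Real.rpow_mul hz0.le, hcast, hm]
          congr 2
          push_cast
          ring
  · by_cases hz : z ∈ ball (0 : EuclideanSpace ℝ (Fin N)) (δ / 2)
    · rw [hnear z hz]
      exact (hΓlap0 z).trans hM0
    by_cases hz' : z ∈ closedBall (0 : EuclideanSpace ℝ (Fin N)) δ
    · have hz1 : δ / 2 ≤ ‖z‖ := by simpa using hz
      have hz2 : ‖z‖ ≤ δ := by simpa using hz'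
      have hsq : (δ / 2) ^ 2 ≤ ‖z‖ ^ 2 + ρ ^ 2 := by nlinarith
      have hΓP : Γ z ≤ P :=
        Real.rpow_le_rpow_of_nonpos (by positivity) hsq (by linarith)
      have hpdQ : ∀ i, |partialDeriv i Γ z| ≤ Q := by
        intro i
        have hzi : |z i| ≤ ‖z‖ := by simpa using PiLp.norm_apply_le z i
        have h1 : (‖z‖ ^ 2 + ρ ^ 2) ^ (-m - 1) ≤ ((δ / 2) ^ 2) ^ (-m - 1) :=
          Real.rpow_le_rpow_of_nonpos (by positivity) hsq (by linarith)
        have h2 : 0 < (‖z‖ ^ 2 + ρ ^ 2) ^ (-m - 1) := by positivity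
        rw [hpdΓ, abs_mul, abs_mul, abs_mul, abs_neg, abs_two, abs_of_pos hm0, abs_of_pos h2]
        calc 2 * |z i| * (m * (‖z‖ ^ 2 + ρ ^ 2) ^ (-m - 1))
            ≤ 2 * δ * (m * ((δ / 2) ^ 2) ^ (-m - 1)) := by
              gcongr
              exact hzi.trans hz2
          _ = Q := by
              rw [hQ]
              ring
      refine le_trans ?_ (hM z hz')
      rw [hlapG]
      have t1 : classicalLaplacian κ z * Γ z ≤ |classicalLaplacian κ z| * P :=
        mul_le_mul (le_abs_self _) hΓP (hΓ0 z) (abs_nonneg _)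
      have t2 : ∑ i, partialDeriv i κ z * partialDeriv i Γ z ≤ ∑ i, |partialDeriv i κ z| * Q := by
        refine Finset.sum_le_sum fun i _ => (le_abs_self _).trans ?_
        rw [abs_mul]
        gcongr
        exact hpdQ i
      have t3 : κ z * classicalLaplacian Γ z ≤ 0 :=
        mul_nonpos_of_nonneg_of_nonpos κ.nonneg (hΓlap0 z)
      linarith
    · have hzs : z ∉ tsupport κ := by rwa [hκs]
      rw [hlapG, classicalLaplacian_eq_zero_of_notMem_tsupport hzs,
        image_eq_zero_of_notMem_tsupport hzs]
      simpa [partialDeriv_eq_zero_of_notMem_tsupport hzs] using hM0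
  · have hz1 : ‖z‖ ≤ ρ := by simpa using hz
    rw [hnear z (mem_ball_zero_iff.2 (hz1.trans_lt hρδ)), hlapΓ, neg_le_neg_iff]
    have h1 : (2 * ρ ^ 2) ^ (-m - 2) ≤ (‖z‖ ^ 2 + ρ ^ 2) ^ (-m - 2) :=
      Real.rpow_le_rpow_of_nonpos (hpos z) (by nlinarith [norm_nonneg z]) (by linarith)
    have h2 : (2 * ρ ^ 2) ^ (-m - 2) = 2 ^ (-m - 2) * (ρ ^ 2 * ρ ^ N)⁻¹ := by
      rw [Real.mul_rpow (by norm_num) hb.le]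
      congr 1
      rw [← pow_add, show -m - 2 = -(m + 2) by ring, Real.rpow_neg hb.le, ← Real.rpow_natCast,
        ← Real.rpow_natCast, ← Real.rpow_mul hρ.le, hm]
      congr 2
      push_cast
      ring
    calc 2 * m * N * 2 ^ (-m - 2) / ρ ^ N
        = 2 * m * N * ρ ^ 2 * (2 ^ (-m - 2) * (ρ ^ 2 * ρ ^ N)⁻¹) := by
          field_simp
      _ ≤ _ := by
          rw [← h2]
          gcongr

/-- A nonnegative function whose Laplacian is a locally integrable function plus a Dirac mass is
locally dominated by the Newtonian potential of a finite measure. -/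
theorem exists_le_newtonPotential (hN : 3 ≤ N) (hu : LocallyIntegrableOn u Ω)
    (hv : LocallyIntegrableOn v Ω) {β : ℝ}
    (h : distribLaplacian (regularDistribution Ω u) =
      regularDistribution Ω v - β • (Distribution.delta 0 : 𝓓'(Ω, ℝ)))
    (hu0 : ∀ᵐ x, x ∈ Ω → 0 ≤ u x) {K : Set (EuclideanSpace ℝ (Fin N))} (hK : IsCompact K)
    (hKΩ : K ⊆ Ω) :
    ∃ μ : Measure (EuclideanSpace ℝ (Fin N)), IsFiniteMeasure μ ∧
      ∀ᵐ y ∂(volume.restrict K), ENNReal.ofReal (u y) ≤ ∫⁻ x, newtonKernel N (x - y) ∂μ := by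
  obtain ⟨δ, hδ, hδΩ⟩ := hK.exists_cthickening_subset_open Ω.isOpen hKΩ
  set K' := cthickening δ K with hK'
  have hK'c : IsCompact K' := hK.cthickening
  have hballK : ∀ y ∈ K, closedBall y δ ⊆ K' := fun y hy =>
    closedBall_subset_cthickening hy δ
  have huK : IntegrableOn u K' := (hu.mono_set hδΩ).integrableOn_isCompact hK'c
  have hvK : IntegrableOn v K' := (hv.mono_set hδΩ).integrableOn_isCompact hK'c
  obtain ⟨c, M, hc, hM, hG⟩ := exists_truncated_newtonKernel hN hδ
  obtain ⟨R, hR, hKR⟩ := hK.isBounded.exists_pos_norm_le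
  set V : ℝ := volume.real (ball (0 : EuclideanSpace ℝ (Fin N)) 1) with hV
  have hV0 : 0 < V := ENNReal.toReal_pos (measure_ball_pos _ _ one_pos).ne' measure_ball_lt_top.ne
  set I : ℝ := M * ∫ x in K', u x with hI
  have huK0 : ∀ᵐ x ∂(volume.restrict K'), 0 ≤ u x := by
    refine (ae_restrict_iff' hK'c.measurableSet).2 ?_
    filter_upwards [hu0] with x hx hxK using hx (hδΩ hxK)
  have hI0 : 0 ≤ I := mul_nonneg hM (integral_nonneg_of_ae huK0)
  -- the estimate at a fixed scale
  have hscale : ∀ y ∈ K, y ≠ 0 → ∀ ρ, 0 < ρ → ρ < δ / 2 →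
      ENNReal.ofReal (c * V * ⨍ x in closedBall y ρ, u x) ≤
        ENNReal.ofReal I + (∫⁻ x in K', newtonKernel N (x - y) * ‖v x‖ₑ) +
          ENNReal.ofReal |β| * newtonKernel N (0 - y) := by
    intro y hy hy0 ρ hρ hρδ
    obtain ⟨G, hGs, hGsupp, hG0, hGle, hGM, hGc⟩ := hG ρ hρ hρδ
    set ψ : EuclideanSpace ℝ (Fin N) → ℝ := fun x => G (x - y) with hψ
    have hψs : ContDiff ℝ ∞ ψ := hGs.comp (contDiff_id.sub contDiff_const)
    have hψsupp : tsupport ψ ⊆ closedBall y δ := by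
      refine closure_minimal (fun x hx => ?_) isClosed_closedBall
      have : x - y ∈ closedBall (0 : EuclideanSpace ℝ (Fin N)) δ := hGsupp (subset_tsupport G hx)
      simpa [dist_eq_norm] using this
    have hψc : HasCompactSupport ψ :=
      (isCompact_closedBall y δ).of_isClosed_subset (isClosed_tsupport ψ) hψsupp
    have hψK : tsupport ψ ⊆ K' := hψsupp.trans (hballK y hy)
    have hψlap : classicalLaplacian ψ = fun x => classicalLaplacian G (x - y) :=
      classicalLaplacian_comp_sub y
    have hψ0 : ∀ x ∉ K', ψ x = 0 := fun x hx =>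
      image_eq_zero_of_notMem_tsupport fun hx' => hx (hψK hx')
    have hψl0 : ∀ x ∉ K', classicalLaplacian ψ x = 0 := fun x hx =>
      classicalLaplacian_eq_zero_of_notMem_tsupport fun hx' => hx (hψK hx')
    have hi1 : Integrable fun x => classicalLaplacian ψ x * u x :=
      hu.integrable_continuousOn_mul hK'c hδΩ hψs.continuous_classicalLaplacian.continuousOn hψl0
    have hi2 : Integrable fun x => ψ x * v x :=
      hv.integrable_continuousOn_mul hK'c hδΩ hψs.continuous.continuousOn hψ0
    have htest : ∫ x, classicalLaplacian ψ x * u x = (∫ x, ψ x * v x) - β * ψ 0 := by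
      have h1 := congrArg (fun T : 𝓓'(Ω, ℝ) => T ⟨ψ, hψs, hψc, hψK.trans hδΩ⟩) h
      have h2 : distribLaplacian (regularDistribution Ω u) ⟨ψ, hψs, hψc, hψK.trans hδΩ⟩ =
        regularDistribution Ω v ⟨ψ, hψs, hψc, hψK.trans hδΩ⟩ - β * ψ 0 := h1
      rw [distribLaplacian_regularDistribution_apply hu, regularDistribution_apply hv] at h2
      exact h2
    have hsetK : ∫ x, classicalLaplacian ψ x * u x = ∫ x in K', classicalLaplacian ψ x * u x :=
      (setIntegral_eq_integral_of_forall_compl_eq_zero fun x hx => by simp [hψl0 x hx]).symm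
    have hsub : closedBall y ρ ⊆ K' := (closedBall_subset_closedBall (by linarith)).trans (hballK y hy)
    have hiB : IntegrableOn u (closedBall y ρ) := huK.mono_set hsub
    -- On `K'` the function `M - Δψ` is nonnegative, and it is at least `c / ρ ^ N` on the small
    -- ball; integrate it against `u ≥ 0`.
    have hkey : c / ρ ^ N * ∫ x in closedBall y ρ, u x ≤
        I - ∫ x, classicalLaplacian ψ x * u x := by
      rw [hsetK, hI, ← integral_const_mul, ← integral_const_mul,
        ← integral_sub (huK.const_mul M) hi1.integrableOn,
        ← inter_eq_self_of_subset_right hsub, ← setIntegral_indicator measurableSet_closedBall]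
      refine integral_mono_ae ?_ ((huK.const_mul M).sub hi1.integrableOn) ?_
      · exact ((integrable_indicator_iff measurableSet_closedBall).2
          (hiB.const_mul (c / ρ ^ N))).integrableOn
      · filter_upwards [huK0] with x hx
        by_cases hxB : x ∈ closedBall y ρ
        · have h1 : classicalLaplacian ψ x ≤ -(c / ρ ^ N) := by
            rw [hψlap]
            exact hGc _ (by simpa [dist_eq_norm] using hxB)
          rw [indicator_of_mem hxB]
          nlinarith [mul_nonneg hM hx]
        · have h1 : classicalLaplacian ψ x ≤ M := by
            rw [hψlap]
            exact hGM _
          rw [indicator_of_notMem hxB]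
          nlinarith
    have havg : c * V * ⨍ x in closedBall y ρ, u x = c / ρ ^ N * ∫ x in closedBall y ρ, u x := by
      have hvol : volume.real (closedBall y ρ) = ρ ^ N * V := by
        rw [Measure.real, Measure.addHaar_closedBall _ _ hρ.le, ENNReal.toReal_mul,
          ENNReal.toReal_ofReal (by positivity), hV, Measure.real]
        simp
      rw [setAverage_eq, hvol, smul_eq_mul]
      field_simp
    have hreal : c * V * ⨍ x in closedBall y ρ, u x ≤ I + (∫ x, |ψ x * v x|) + |β| * ψ 0 := by
      rw [havg]
      have h1 := (neg_abs_le (∫ x, ψ x * v x)).trans' (neg_le_neg (abs_integral_le_integral_abs))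
      have h2 : β * ψ 0 ≤ |β| * ψ 0 := mul_le_mul_of_nonneg_right (le_abs_self β) (hG0 _)
      linarith
    refine (ENNReal.ofReal_le_ofReal hreal).trans ?_
    refine ENNReal.ofReal_add_le.trans (add_le_add (ENNReal.ofReal_add_le.trans
      (add_le_add le_rfl ?_)) ?_)
    · rw [ofReal_integral_eq_lintegral_ofReal hi2.abs (Eventually.of_forall fun x => abs_nonneg _),
        ← lintegral_indicator hK'c.measurableSet]
      refine lintegral_mono_ae ?_
      filter_upwards [compl_mem_ae_iff.2 (show volume {y} = 0 by
        have : Nonempty (Fin N) := ⟨⟨0, by omega⟩⟩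
        exact measure_singleton y)] with x hx
      have hxy : x - y ≠ 0 := sub_ne_zero.2 hx
      by_cases hxK : x ∈ K'
      · rw [indicator_of_mem hxK, abs_mul, ENNReal.ofReal_mul (abs_nonneg _),
          newtonKernel_eq_ofReal hxy, Real.enorm_eq_ofReal_abs, abs_of_nonneg (hG0 _)]
        gcongr
        exact hGle _ hxy
      · simp [hψ0 x hxK]
    · have hy' : (0 : EuclideanSpace ℝ (Fin N)) - y ≠ 0 := by simpa using hy0
      rw [ENNReal.ofReal_mul (abs_nonneg _), newtonKernel_eq_ofReal hy']
      gcongr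
      exact hGle _ hy'
  -- absorbing the constant into the Dirac mass
  have hconst : ∀ y ∈ K, y ≠ 0 →
      ENNReal.ofReal I ≤ ENNReal.ofReal (I * R ^ (N - 2)) * newtonKernel N (0 - y) := by
    intro y hy hy0
    have hy1 : 0 < ‖y‖ := norm_pos_iff.2 hy0
    rw [newtonKernel_eq_ofReal (by simpa using hy0), ← ENNReal.ofReal_mul (by positivity)]
    refine ENNReal.ofReal_le_ofReal ?_
    rw [zero_sub, norm_neg, ← div_eq_mul_inv, le_div_iff₀ (by positivity)]
    gcongr
    exact hKR y hy
  set a : ENNReal := ENNReal.ofReal |β| + ENNReal.ofReal (I * R ^ (N - 2)) with ha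
  -- `ν` carries the density `|v|` on `K'` and, at the origin, the mass `|β|` plus the mass that
  -- absorbs `I`.
  set ν : Measure (EuclideanSpace ℝ (Fin N)) :=
    (volume.restrict K').withDensity (fun x => ‖v x‖ₑ) + a • Measure.dirac 0 with hν
  have hνfin : IsFiniteMeasure ν := by
    have h1 : IsFiniteMeasure ((volume.restrict K').withDensity (fun x => ‖v x‖ₑ)) :=
      isFiniteMeasure_withDensity hvK.2.ne
    have h2 : IsFiniteMeasure (a • Measure.dirac (0 : EuclideanSpace ℝ (Fin N))) :=
      Measure.smul_finite _ (by simp [ha])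
    infer_instance
  have hνint : ∀ y, ∫⁻ x, newtonKernel N (x - y) ∂ν =
      (∫⁻ x in K', newtonKernel N (x - y) * ‖v x‖ₑ) + a * newtonKernel N (0 - y) := by
    intro y
    have hmk : Measurable fun x => newtonKernel N (x - y) :=
      measurable_newtonKernel.comp (measurable_id.sub_const y)
    rw [hν, lintegral_add_measure, lintegral_smul_measure, lintegral_dirac' _ hmk, smul_eq_mul,
      lintegral_withDensity_eq_lintegral_mul₀ hvK.1.enorm hmk.aemeasurable]
    simp only [Pi.mul_apply, mul_comm]
  refine ⟨ENNReal.ofReal (c * V)⁻¹ • ν, Measure.smul_finite _ ENNReal.ofReal_ne_top, ?_⟩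
  -- The right-hand side of `hscale` is free of `ρ`, so letting `ρ → 0` turns averages into values
  -- of `u`. The indicator extends `u` to a globally locally integrable function; the parameter `1`
  -- suffices since the balls are concentric.
  have hLeb := IsUnifLocDoublingMeasure.ae_tendsto_average volume
    (((integrable_indicator_iff hK'c.measurableSet).2 huK).locallyIntegrable) 1
  filter_upwards [ae_restrict_of_ae hLeb, ae_restrict_mem hK.measurableSet,
    ae_restrict_of_ae (ae_ne_zero_euclideanSpace (by omega : 1 ≤ N))] with y hyL hyK hy0
  have hT : Tendsto (fun ρ => ⨍ x in closedBall y ρ, K'.indicator u x) (𝓝[>] (0 : ℝ))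
      (𝓝 (u y)) := by
    have hyK' : y ∈ K' := hballK y hyK (mem_closedBall_self hδ.le)
    have := hyL (l := 𝓝[>] (0 : ℝ)) (fun _ => y) (fun ρ => ρ) tendsto_id
      (eventually_mem_nhdsWithin.mono fun ρ hρ => mem_closedBall_self (by
        rw [one_mul]
        exact (mem_Ioi.1 hρ).le))
    rwa [indicator_of_mem hyK'] at this
  have hT' := (ENNReal.continuous_ofReal.tendsto _).comp (hT.const_mul (c * V))
  have hbound : ENNReal.ofReal (c * V * u y) ≤ ∫⁻ x, newtonKernel N (x - y) ∂ν := by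
    refine le_of_tendsto hT' ?_
    filter_upwards [Ioo_mem_nhdsGT (show (0 : ℝ) < δ / 2 by positivity)] with ρ hρ
    have hsub : closedBall y ρ ⊆ K' :=
      (closedBall_subset_closedBall (by linarith [hρ.2])).trans (hballK y hyK)
    have hav : ⨍ x in closedBall y ρ, K'.indicator u x = ⨍ x in closedBall y ρ, u x :=
      setAverage_congr_fun measurableSet_closedBall
        (Eventually.of_forall fun x hx => indicator_of_mem (hsub hx) u)
    simp only [Function.comp, hav]
    refine (hscale y hyK hy0 ρ hρ.1 hρ.2).trans ?_
    rw [hνint, ha, add_mul]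
    calc _ ≤ ENNReal.ofReal (I * R ^ (N - 2)) * newtonKernel N (0 - y) +
          (∫⁻ x in K', newtonKernel N (x - y) * ‖v x‖ₑ) +
          ENNReal.ofReal |β| * newtonKernel N (0 - y) := by
            gcongr
            exact hconst y hyK hy0
      _ = _ := by ring
  rw [lintegral_smul_measure, smul_eq_mul]
  calc ENNReal.ofReal (u y) = ENNReal.ofReal (c * V)⁻¹ * ENNReal.ofReal (c * V * u y) := by
        rw [← ENNReal.ofReal_mul (by positivity)]
        congr 1
        field_simp
    _ ≤ _ := by gcongr

/-- Local weak-type regularity of nonnegative functions whose Laplacian is a locally integrable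
function plus a Dirac mass. -/
theorem memMarcinkiewiczLoc_of_distribLaplacian_eq (hN : 3 ≤ N) (hu : LocallyIntegrableOn u Ω)
    (hv : LocallyIntegrableOn v Ω) {β : ℝ}
    (h : distribLaplacian (regularDistribution Ω u) =
      regularDistribution Ω v - β • (Distribution.delta 0 : 𝓓'(Ω, ℝ)))
    (hu0 : ∀ᵐ x, x ∈ Ω → 0 ≤ u x) :
    MemMarcinkiewiczLoc u ((N : ℝ) / ((N : ℝ) - 2)) Ω := by
  intro K hKΩ hK
  refine ⟨((hu.mono_set hKΩ).integrableOn_isCompact hK).aestronglyMeasurable, ?_⟩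
  obtain ⟨μ, hμ, hle⟩ := exists_le_newtonPotential hN hu hv h hu0 hK hKΩ
  obtain ⟨C, hC⟩ := volume_lt_newtonPotential_le hN μ
  refine ⟨C, fun t ht => ?_⟩
  refine le_trans ?_ (hC K hK.measurableSet hK.measure_lt_top.ne t ht)
  rw [← Measure.restrict_apply' hK.measurableSet]
  refine measure_mono_ae ?_
  filter_upwards [hle, ae_restrict_of_ae hu0, ae_restrict_mem hK.measurableSet] with y h1 h2 h3 h4
  have h5 : t < u y := by
    have h6 : t < |u y| := h4
    rwa [abs_of_nonneg (h2 (hKΩ h3))] at h6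
  exact ((ENNReal.ofReal_lt_ofReal_iff (ht.trans h5)).2 h5).trans_le h1

end PointwiseBound

/-! ### The bi-Laplacian theorem. -/

theorem distribLaplacian_regularDistribution_neg {N : ℕ} {Ω : Opens (EuclideanSpace ℝ (Fin N))}
    {u v : EuclideanSpace ℝ (Fin N) → ℝ} (hu : LocallyIntegrableOn u Ω)
    (hv : LocallyIntegrableOn v Ω)
    (h : distribLaplacian (regularDistribution Ω u) = regularDistribution Ω v) :
    distribLaplacian (regularDistribution Ω fun x => -u x) =
      regularDistribution Ω fun x => -v x := by
  ext χ
  have hχ := congrArg (fun T : 𝓓'(Ω, ℝ) => T χ) h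
  simp only [distribLaplacian_regularDistribution_apply hu, regularDistribution_apply hv] at hχ
  rw [distribLaplacian_regularDistribution_apply (u := fun x => -u x) hu.neg,
    regularDistribution_apply (f := fun x => -v x) hv.neg]
  simp only [mul_neg, integral_neg, hχ]

theorem theorem2p5 (N : ℕ) (hN : 4 ≤ N) (Ω : Opens (EuclideanSpace ℝ (Fin N)))
    (h0 : (0 : EuclideanSpace ℝ (Fin N)) ∈ Ω)
    -- the nonlinearity: only its values on `Ω' × [0, ∞)` matter
    (g : EuclideanSpace ℝ (Fin N) → ℝ → ℝ)
    (hg_meas : AEMeasurable (fun z : EuclideanSpace ℝ (Fin N) × ℝ => g z.1 z.2)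
      (volume.restrict
        ((punctured Ω : Set (EuclideanSpace ℝ (Fin N))) ×ˢ Set.Ici (0 : ℝ))))
    (hg_nonneg : ∀ x ∈ punctured Ω, ∀ t : ℝ, 0 ≤ t → 0 ≤ g x t)
    -- `u`, its distributional Laplacian `Δu = v`, and `Δ²u = g(x, u)` are in `L¹_loc(Ω')`
    (u v : EuclideanSpace ℝ (Fin N) → ℝ)
    (hu : LocallyIntegrableOn u (punctured Ω))
    (hv : LocallyIntegrableOn v (punctured Ω))
    (hgu : LocallyIntegrableOn (fun x => g x (u x)) (punctured Ω))
    (hlap : distribLaplacian (regularDistribution (punctured Ω) u) =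
      regularDistribution (punctured Ω) v)
    (hbilap : distribLaplacian (distribLaplacian (regularDistribution (punctured Ω) u)) =
      regularDistribution (punctured Ω) (fun x => g x (u x)))
    (hu_nonneg : ∀ᵐ x, x ∈ punctured Ω → 0 ≤ u x)
    (hv_nonneg : ∀ᵐ x, x ∈ punctured Ω → 0 ≤ - v x) :
    LocallyIntegrableOn u Ω ∧
    LocallyIntegrableOn (fun x => g x (u x)) Ω ∧
    (∃ α β : ℝ, 0 ≤ α ∧ 0 ≤ β ∧
      distribLaplacian (distribLaplacian (regularDistribution Ω u)) =
        regularDistribution Ω (fun x => g x (u x)) +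
          α • (Distribution.delta 0 : 𝓓'(Ω, ℝ)) -
          β • distribLaplacian (Distribution.delta 0 : 𝓓'(Ω, ℝ))) ∧
    MemMarcinkiewiczLoc u ((N : ℝ) / ((N : ℝ) - 2)) Ω := by
  have hg0 : ∀ᵐ x, x ∈ punctured Ω → 0 ≤ - -(g x (u x)) := by
    filter_upwards [hu_nonneg] with x hx hxΩ
    simpa using hg_nonneg x hxΩ _ (hx hxΩ)
  rw [hlap] at hbilap
  obtain ⟨huΩ, hvΩ, β, hβ, hβeq⟩ := brezis_lions hN h0 hu hv hlap hu_nonneg hv_nonneg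
  -- The second application is to `-v`, which is nonnegative with Laplacian `-g(x, u) ≤ 0`.
  obtain ⟨-, hgΩ', α, hα, hαeq⟩ := brezis_lions hN h0 hv.neg hgu.neg
    (distribLaplacian_regularDistribution_neg hv hgu hbilap) hv_nonneg hg0
  have hgΩ : LocallyIntegrableOn (fun x => g x (u x)) Ω := by simpa using hgΩ'.neg
  have hu0 : ∀ᵐ x, x ∈ Ω → 0 ≤ u x := by
    filter_upwards [hu_nonneg, ae_ne_zero_euclideanSpace (by omega : 1 ≤ N)] with x h1 h2 hx
    exact h1 ⟨hx, h2⟩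
  refine ⟨huΩ, hgΩ, ⟨α, β, hα, hβ, ?_⟩,
    memMarcinkiewiczLoc_of_distribLaplacian_eq (by omega) huΩ hvΩ hβeq hu0⟩
  ext χ
  set Lχ : 𝓓(Ω, ℝ) := ∑ i : Fin N,
    ∂_{EuclideanSpace.single i (1 : ℝ)} (∂_{EuclideanSpace.single i (1 : ℝ)} χ) with hL
  -- One Laplacian is moved onto the test function, so that the formula for `Δu` on all of `Ω` can
  -- be evaluated at `Δχ`.
  have h1 : distribLaplacian (distribLaplacian (regularDistribution Ω u)) χ =
      regularDistribution Ω v Lχ - β * Lχ 0 := by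
    rw [distribLaplacian_apply, hβeq]
    rfl
  have h2 : regularDistribution Ω v Lχ = ∫ x, classicalLaplacian χ x * v x := by
    rw [← distribLaplacian_regularDistribution_apply hvΩ, distribLaplacian_apply]
  have h3 : ∫ x, classicalLaplacian χ x * -v x = (∫ x, χ x * -g x (u x)) - α * χ 0 := by
    have h := congrArg (fun T : 𝓓'(Ω, ℝ) => T χ) hαeq
    have h' : distribLaplacian (regularDistribution Ω (-v)) χ =
      regularDistribution Ω (-fun x => g x (u x)) χ - α * χ 0 := h
    rw [distribLaplacian_regularDistribution_apply hvΩ.neg, regularDistribution_apply hgΩ.neg] at h'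
    exact h'
  have h4 : (distribLaplacian (Distribution.delta 0 : 𝓓'(Ω, ℝ))) χ = Lχ 0 := by
    rw [distribLaplacian_apply]
    rfl
  change _ = regularDistribution Ω (fun x => g x (u x)) χ + α * χ 0 -
    β * (distribLaplacian (Distribution.delta 0 : 𝓓'(Ω, ℝ))) χ
  simp only [mul_neg, integral_neg] at h3
  rw [h1, h2, h4, regularDistribution_apply hgΩ]
  linarith
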